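/- Let $G$ be an analytic Moufang loop of dimension $r$ (a quasigroup with unit $e$ satisfying $(ag)(ha)=a(gh)a$, which is a real analytic manifold with analytic multiplication and inversion). Let $(S,T)$ be a differentiable birepresentation of $G$ in $GL_n(\mathbb K)$, $\mathbb K\in\{\mathbb R,\mathbb C\}$, i.e. differentiable maps $g\mapsto S_g$, $g\mapsto T_g$ into $GL_n(\mathbb K)$ with $$S_e=T_e=1,\qquad T_gS_gS_h=S_{gh}T_g,\qquad S_gT_gT_h=T_{hg}S_g\qquad(g,h\in G).$$ For $x\in T_e(G)$ let $S_x,T_x$ be the derivatives of $S,T$ at $e$ in the direction $x$, and put $S_x(g)=T_gS_xT_g^{-1}$, $T_x(g)=S_g^{-1}T_xS_g$. Let $v_x$ be the vector field on $G$ whose value at $g$ is the image of $x$ under the differential at $h=e$ of $h\mapsto gh$, and define $[x,y]_g\in T_e(G)$ by $v_{[x,y]_g}(g)=[v_x,v_y](g)$, where $[V,W]^i=V^n\partial_nW^i-W^n\partial_nV^i$. Put $$[x,y,z]_g=[x,[y,z]_g]_g-[y,[x,z]_g]_g+[[x,y]_g,z]_g,$$ $$3Y_g(x;y)=[S_x(g),S_y(g)]+[S_x(g),T_y(g)]+[T_x(g),T_y(g)],$$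 where $[A,B]=AB-BA$ for matrices. Then for all $g\in G$ and $x,y,z,w\in T_e(G)$: $$[S_x(g),S_y(g)]=2Y_g(x;y)+\tfrac13S_{[x,y]_g}(g)+\tfrac23T_{[x,y]_g}(g),\tag{1}$$ $$[S_x(g),T_y(g)]=-Y_g(x;y)+\tfrac13S_{[x,y]_g}(g)-\tfrac13T_{[x,y]_g}(g),\tag{2}$$ $$[T_x(g),T_y(g)]=2Y_g(x;y)-\tfrac23S_{[x,y]_g}(g)-\tfrac13T_{[x,y]_g}(g),\tag{3}$$ $$6[Y_g(x;y),S_z(g)]=S_{[x,y,z]_g}(g),\tag{4}$$ $$6[Y_g(x;y),T_z(g)]=T_{[x,y,z]_g}(g),\tag{5}$$ $$6[Y_g(x;y),Y_g(z;w)]=Y_g([x,y,z]_g;w)+Y_g(z;[x,y,w]_g).\tag{6}$$ For every $g\in G$ the real linear span $\mathfrak l_g$ of all $S_x(g)$, $T_x(g)$, $Y_g(x;y)$ ($x,y\in T_e(G)$) is closed under commutators, hence a Lie algebra, and $\dim_{\mathbb R}\mathfrak l_g\le 2r+r(r-1)/2$. If $G$ is connected, then $\mathfrak l_e$ is the Lie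 algebra of the multiplication group of the birepresentation, i.e. of the subgroup $H$ of $GL_n(\mathbb K)$ generated by all $S_g$, $T_g$ ($g\in G$); here the Lie algebra of a (not necessarily closed) subgroup $H$ is the set of velocities $\gamma'(0)$ of $C^1$ curves $\gamma$ in $H$, defined near $0$, with $\gamma(0)=1$. -/

import Mathlib

open scoped Manifold ContDiff Topology

/-- A Moufang loop: a quasigroup with unit `1`, satisfying the Moufang identity
`(a g) (h a) = a (g h) a`. The two-sided inverse is part of the notation. -/
class MoufangLoop (G : Type*) extends Mul G, One G, Inv G where
  existsUnique_mul_left : ∀ a b : G, ∃! x : G, a * x = b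
  existsUnique_mul_right : ∀ a b : G, ∃! y : G, y * a = b
  one_mul' : ∀ g : G, 1 * g = g
  mul_one' : ∀ g : G, g * 1 = g
  mul_inv' : ∀ g : G, g * g⁻¹ = 1
  inv_mul' : ∀ g : G, g⁻¹ * g = 1
  moufang : ∀ a g h : G, (a * g) * (h * a) = (a * (g * h)) * a

/-- An analytic Moufang loop of dimension `r`: a Moufang loop which is a real analytic manifold
such that multiplication and inversion are analytic. -/
class AnalyticMoufangLoop (r : ℕ) (G : Type*) [TopologicalSpace G]
    [ChartedSpace (EuclideanSpace ℝ (Fin r)) G] [MoufangLoop G] : Prop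
    extends IsManifold (𝓡 r) ω G where
  contMDiff_mul : ContMDiff ((𝓡 r).prod (𝓡 r)) (𝓡 r) ω (fun p : G × G => p.1 * p.2)
  contMDiff_inv : ContMDiff (𝓡 r) (𝓡 r) ω (fun g : G => g⁻¹)

namespace MoufangLoop

section Loop

variable {G : Type*} [MoufangLoop G]

theorem inv_inv' (g : G) : g⁻¹⁻¹ = g :=
  (existsUnique_mul_left g⁻¹ (1 : G)).unique (mul_inv' g⁻¹) (inv_mul' g)

theorem mul_inv_mul (g h : G) : g * (g⁻¹ * h) = h := by
  have key := moufang g g⁻¹ h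
  rw [mul_inv', one_mul'] at key
  exact (existsUnique_mul_right g (h * g)).unique key.symm rfl

theorem inv_mul_mul (g h : G) : g⁻¹ * (g * h) = h := by
  have key := mul_inv_mul g⁻¹ h
  rwa [inv_inv'] at key

end Loop

section Analytic

variable (r : ℕ) {G : Type*} [TopologicalSpace G] [ChartedSpace (EuclideanSpace ℝ (Fin r)) G]
  [MoufangLoop G]

/-- The auxiliary functions `v(g) : T_e G → T_g G`, the differential at `h = e` of `h ↦ g h`.
In coordinates its matrix is `v_j^n(g) = ∂(gh)^n / ∂h^j` at `h = e`. -/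
noncomputable def aux (g : G) :
    TangentSpace (𝓡 r) (1 : G) →L[ℝ] TangentSpace (𝓡 r) g :=
  (mfderiv (𝓡 r) (𝓡 r) (fun h : G => g * h) 1 :
    EuclideanSpace ℝ (Fin r) →L[ℝ] EuclideanSpace ℝ (Fin r))

/-- The product `[x, y]_g = c^i_{jk}(g) x^j y^k` of the derivative of the tangent algebra.
The structure functions are determined by the generalized Maurer-Cartan equations
`v_j^n ∂_n v_k^i - v_k^n ∂_n v_j^i = c_{jk}^n v_n^i`, that is,
`v(g) [x, y]_g` is the Lie bracket at `g` of the vector fields `v(·) x` and `v(·) y`.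
See `aux_bracket`. -/
noncomputable def bracket (g : G) (x y : TangentSpace (𝓡 r) (1 : G)) :
    TangentSpace (𝓡 r) (1 : G) :=
  (aux r g).inverse
    (VectorField.mlieBracket (𝓡 r) (fun k : G => aux r k x) (fun k : G => aux r k y) g)

/-- The Yamaguti brackets `[x, y, z]_g = [x,[y,z]_g]_g - [y,[x,z]_g]_g + [[x,y]_g,z]_g`. -/
noncomputable def yamaguti (g : G) (x y z : TangentSpace (𝓡 r) (1 : G)) :
    TangentSpace (𝓡 r) (1 : G) :=
  bracket r g x (bracket r g y z) - bracket r g y (bracket r g x z)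
    + bracket r g (bracket r g x y) z

variable [AnalyticMoufangLoop r G]

theorem contMDiff_mul_left (g : G) : ContMDiff (𝓡 r) (𝓡 r) ω (fun h : G => g * h) :=
  (AnalyticMoufangLoop.contMDiff_mul (r := r) (G := G)).comp
    (contMDiff_const.prodMk contMDiff_id)

theorem aux_isInvertible (g : G) : (aux r g).IsInvertible := by
  have hd : ∀ a b : G, MDifferentiableAt (𝓡 r) (𝓡 r) (fun h : G => a * h) b := fun a b =>
    (contMDiff_mul_left r a).mdifferentiableAt (by simp)
  have h1 : mfderiv (𝓡 r) (𝓡 r) (fun h : G => g⁻¹ * h) (g * 1) ∘L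
      mfderiv (𝓡 r) (𝓡 r) (fun h : G => g * h) (1 : G)
      = ContinuousLinearMap.id ℝ (TangentSpace (𝓡 r) (1 : G)) := by
    rw [← mfderiv_comp (1 : G) (hd _ _) (hd _ _)]
    have : (fun h : G => g⁻¹ * h) ∘ (fun h : G => g * h) = id := by
      funext h; exact inv_mul_mul g h
    rw [this, mfderiv_id]
  have hinj : Function.Injective
      (mfderiv (𝓡 r) (𝓡 r) (fun h : G => g * h) (1 : G)) := by
    intro u v huv
    have hu : mfderiv (𝓡 r) (𝓡 r) (fun h : G => g⁻¹ * h) (g * 1)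
        (mfderiv (𝓡 r) (𝓡 r) (fun h : G => g * h) (1 : G) u) = u :=
      congrArg (fun A => A u) h1
    have hv : mfderiv (𝓡 r) (𝓡 r) (fun h : G => g⁻¹ * h) (g * 1)
        (mfderiv (𝓡 r) (𝓡 r) (fun h : G => g * h) (1 : G) v) = v :=
      congrArg (fun A => A v) h1
    exact hu.symm.trans ((congrArg _ huv).trans hv)
  let A : EuclideanSpace ℝ (Fin r) →L[ℝ] EuclideanSpace ℝ (Fin r) :=
    mfderiv (𝓡 r) (𝓡 r) (fun h : G => g * h) (1 : G)
  let L : EuclideanSpace ℝ (Fin r) ≃ₗ[ℝ] EuclideanSpace ℝ (Fin r) :=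
    LinearEquiv.ofInjectiveEndo A.toLinearMap hinj
  exact ⟨L.toContinuousLinearEquiv, by ext v; rfl⟩

/-- The generalized Maurer-Cartan equations. -/
theorem aux_bracket (g : G) (x y : TangentSpace (𝓡 r) (1 : G)) :
    aux r g (bracket r g x y) =
      VectorField.mlieBracket (𝓡 r) (fun k : G => aux r k x) (fun k : G => aux r k y) g :=
  (aux_isInvertible r g).self_apply_inverse _

end Analytic

end MoufangLoop

/-- A linear birepresentation `(S, T)` of a Moufang loop `G` in `GL_n(𝕜)`. -/
structure IsBirepresentation {G : Type*} [MoufangLoop G] {𝕜 : Type*} [RCLike 𝕜] {n : ℕ}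
    (S T : G → GL (Fin n) 𝕜) : Prop where
  left_one : S 1 = 1
  right_one : T 1 = 1
  left_mul : ∀ g h : G, T g * S g * S h = S (g * h) * T g
  right_mul : ∀ g h : G, S g * T g * T h = T (h * g) * S g

namespace Birepresentation

variable (r : ℕ) {G : Type*} [TopologicalSpace G] [ChartedSpace (EuclideanSpace ℝ (Fin r)) G]
  [MoufangLoop G] {𝕜 : Type*} [RCLike 𝕜] {n : ℕ}

/-- A map into `GL_n(𝕜)` is differentiable if its matrix entries are (real) differentiable. -/
def IsDifferentiable (S : G → GL (Fin n) 𝕜) : Prop :=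
  ∀ i j : Fin n, MDifferentiable (𝓡 r) 𝓘(ℝ, 𝕜) (fun g : G => (S g).val i j)

/-- The generator `x^j S_j`, where `S_j = ∂S_g / ∂g^j` at `g = e` (entry by entry);
used for both `S` and `T`. -/
noncomputable def generator (S : G → GL (Fin n) 𝕜) (x : TangentSpace (𝓡 r) (1 : G)) :
    Matrix (Fin n) (Fin n) 𝕜 :=
  Matrix.of fun i j : Fin n =>
    (mfderiv (𝓡 r) 𝓘(ℝ, 𝕜) (fun g : G => (S g).val i j) 1 x : 𝕜)

/-- The derivative generator `S_x(g) = T_g S_x T_g⁻¹`. -/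
noncomputable def genS (S T : G → GL (Fin n) 𝕜) (g : G) (x : TangentSpace (𝓡 r) (1 : G)) :
    Matrix (Fin n) (Fin n) 𝕜 :=
  (T g : Matrix (Fin n) (Fin n) 𝕜) * generator r S x *
    ((T g)⁻¹ : GL (Fin n) 𝕜)

/-- The derivative generator `T_x(g) = S_g⁻¹ T_x S_g`. -/
noncomputable def genT (S T : G → GL (Fin n) 𝕜) (g : G) (x : TangentSpace (𝓡 r) (1 : G)) :
    Matrix (Fin n) (Fin n) 𝕜 :=
  (((S g)⁻¹ : GL (Fin n) 𝕜) : Matrix (Fin n) (Fin n) 𝕜) * generator r T x *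
    (S g : Matrix (Fin n) (Fin n) 𝕜)

/-- The Yamagutian: `3 Y_g(x;y) = [S_x(g),S_y(g)] + [S_x(g),T_y(g)] + [T_x(g),T_y(g)]`. -/
noncomputable def yamagutian (S T : G → GL (Fin n) 𝕜) (g : G)
    (x y : TangentSpace (𝓡 r) (1 : G)) : Matrix (Fin n) (Fin n) 𝕜 :=
  (1 / 3 : ℝ) • (⁅genS r S T g x, genS r S T g y⁆ + ⁅genS r S T g x, genT r S T g y⁆
    + ⁅genT r S T g x, genT r S T g y⁆)

/-- The real linear span of all `S_x(g)`, `T_x(g)` and `Y_g(x;y)`. -/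
noncomputable def generatorSpan (S T : G → GL (Fin n) 𝕜) (g : G) :
    Submodule ℝ (Matrix (Fin n) (Fin n) 𝕜) :=
  Submodule.span ℝ (Set.range (genS r S T g) ∪ Set.range (genT r S T g) ∪
    {A | ∃ x y : TangentSpace (𝓡 r) (1 : G), A = yamagutian r S T g x y})

/-- The multiplication group of the birepresentation: the group generated by all `S_g`, `T_g`. -/
def multiplicationGroup (S T : G → GL (Fin n) 𝕜) : Subgroup (GL (Fin n) 𝕜) :=
  Subgroup.closure (Set.range S ∪ Set.range T)

end Birepresentation

/-- The (underlying set of the) Lie algebra of a linear group, that is, of a not necessarily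
closed subgroup `H` of `GL_n(𝕜)`: the velocities at the identity of the curves in `H`
that are defined and `C^1` near the parameter value `0`. -/
def linearGroupLieAlgebra {𝕜 : Type*} [RCLike 𝕜] {n : ℕ} (H : Subgroup (GL (Fin n) 𝕜)) :
    Set (Matrix (Fin n) (Fin n) 𝕜) :=
  {X | ∃ γ : ℝ → Matrix (Fin n) (Fin n) 𝕜, γ 0 = 1 ∧
    (∀ᶠ t in 𝓝 (0 : ℝ), ∃ h ∈ H, (h : Matrix (Fin n) (Fin n) 𝕜) = γ t) ∧
    ∀ i j : Fin n, ContDiffAt ℝ 1 (fun t => γ t i j) 0 ∧ HasDerivAt (fun t => γ t i j) (X i j) 0}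

/-! Write `L_x(g)`, `R_x(g)` for the generators `S_x(g)`, `T_x(g)`, and differentiate along the
fields `v_x`. The birepresentation rules give `v_x S = S · L_x` and `v_x T = R_x · T`, and they show
that `L_x(g) + R_x(g)` does not depend on `g`. Along `v_x` the derivative of `L_y` is `[R_x, L_y]`
and that of `R_y` is `[R_y, L_x]`; their sum vanishes, so `[L_x, R_y] = [R_x, L_y]`. Letting `[v_x,
v_y]` act on `S` and on `T` as a commutator of derivations gives `L_{[x,y]} = [L_x, L_y] + 2[L_x,
R_y]` and `R_{[x,y]} = -2[L_x, R_y] - [R_x, R_y]`. These three relations are `IsTrialityPair`,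
proved in `isTrialityPair`. The commutator identities, the closure and the dimension bound follow
from them by the Jacobi identity and linear algebra.

For the multiplication group `H`, one inclusion is direct. Along an integral curve of `v_x` through
the unit `S` and `T` are one-parameter groups, so `S_x` and `T_x` are velocities, and velocities
form a Lie algebra.

The other inclusion must cope with `H` not being closed. Products of integral curves fill a
neighbourhood of the unit, so by connectedness `H` lies in a group generated by finitely many
one-parameter groups with exponents in `V = l_e`. Near the identity there is a function `w` that is
constant in the directions `aV` and whose differential at `1` has kernel in `V`
(`exists_firstIntegral`). Each element of that group is joined, tangentially to the translates of
`V`, to an element of a countable subgroup, so `w` takes only countably many values along a `C^1`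
curve in `H`. By continuity it is constant there, hence the velocity lies in `V`
(`velocitySet_expGroup_subset`). -/

/-! ### Triality relations in a Lie algebra -/

section Triality

variable {V L : Type*} [AddCommGroup V] [Module ℝ V] [LieRing L] [LieAlgebra ℝ L]

/-- A pair of linear maps `S, T` into a Lie algebra such that the mixed brackets are
skew-symmetric and the brackets of `S` and `T` are controlled by a product on the source. -/
structure IsTrialityPair (br : V → V → V) (S T : V →ₗ[ℝ] L) : Prop where
  mixed : ∀ x y, ⁅S x, T y⁆ = ⁅T x, S y⁆
  left : ∀ x y, S (br x y) = ⁅S x, S y⁆ + (2 : ℝ) • ⁅S x, T y⁆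
  right : ∀ x y, T (br x y) = -((2 : ℝ) • ⁅S x, T y⁆) - ⁅T x, T y⁆

/-- The Yamagutian of a pair of maps into a Lie algebra. -/
noncomputable def pairYamagutian (S T : V →ₗ[ℝ] L) (x y : V) : L :=
  (1 / 3 : ℝ) • (⁅S x, S y⁆ + ⁅S x, T y⁆ + ⁅T x, T y⁆)

/-- The triple product of a product. -/
def tripleProduct (br : V → V → V) (x y z : V) : V :=
  br x (br y z) - br y (br x z) + br (br x y) z

namespace IsTrialityPair

variable {br : V → V → V} {S T : V →ₗ[ℝ] L} (h : IsTrialityPair br S T)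
include h

theorem lie_left_left (x y : V) :
    ⁅S x, S y⁆ = (2 : ℝ) • pairYamagutian S T x y + (1 / 3 : ℝ) • S (br x y)
      + (2 / 3 : ℝ) • T (br x y) := by
  rw [h.left, h.right, pairYamagutian]; module

theorem lie_left_right (x y : V) :
    ⁅S x, T y⁆ = -pairYamagutian S T x y + (1 / 3 : ℝ) • S (br x y)
      - (1 / 3 : ℝ) • T (br x y) := by
  rw [h.left, h.right, pairYamagutian]; module

theorem lie_right_right (x y : V) :
    ⁅T x, T y⁆ = (2 : ℝ) • pairYamagutian S T x y - (2 / 3 : ℝ) • S (br x y)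
      - (1 / 3 : ℝ) • T (br x y) := by
  rw [h.left, h.right, pairYamagutian]; module

theorem mixed_swap (x y : V) : ⁅S x, T y⁆ = -⁅S y, T x⁆ := by
  rw [h.mixed, ← lie_skew]

/-- Both sides become combinations of triple brackets, and their difference is a combination of five
Jacobi identities once `mixed` has moved `S` and `T` across the mixed brackets. Additivity of `br`
plays no role. -/
theorem lie_yamagutian_left (x y z : V) :
    (6 : ℝ) • ⁅pairYamagutian S T x y, S z⁆ = S (tripleProduct br x y z) := by
  simp only [tripleProduct, pairYamagutian, map_add, map_sub, h.left, h.right, lie_add, lie_sub,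
    lie_neg, lie_smul, add_lie, smul_lie]
  have j1 := lie_lie (S x) (S y) (S z)
  have j2 := lie_lie (S x) (S y) (T z)
  have j3 := lie_lie (T x) (T y) (S z)
  have j4 : ⁅S x, ⁅T y, T z⁆⁆ = ⁅⁅S x, T y⁆, T z⁆ + ⁅T y, ⁅S x, T z⁆⁆ := leibniz_lie _ _ _
  have j5 : ⁅S y, ⁅T x, T z⁆⁆ = ⁅⁅S y, T x⁆, T z⁆ + ⁅T x, ⁅S y, T z⁆⁆ := leibniz_lie _ _ _
  rw [h.mixed_swap y x, neg_lie] at j5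
  rw [← h.mixed x z, ← h.mixed y z] at j3
  linear_combination (norm := module) j1 - (2 : ℝ) • j2 + (2 : ℝ) • j3 + (2 : ℝ) • j4
    - (2 : ℝ) • j5

/-- The pair `(T, S)` with the opposite product is again a triality pair up to sign. -/
theorem swap : IsTrialityPair (fun x y => -br x y) T S where
  mixed x y := (h.mixed x y).symm
  left x y := by rw [map_neg, h.right, h.mixed]; module
  right x y := by rw [map_neg, h.left, h.mixed]; module

/-- This is the previous identity for the swapped pair. The Yamagutian is symmetric under the swap,
and the triple product involves `br` twice, so for odd `br` the sign cancels. -/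
theorem lie_yamagutian_right (hl : ∀ x y, br x (-y) = -br x y) (hr : ∀ x y, br (-x) y = -br x y)
    (x y z : V) :
    (6 : ℝ) • ⁅pairYamagutian S T x y, T z⁆ = T (tripleProduct br x y z) := by
  have key := h.swap.lie_yamagutian_left x y z
  have e : tripleProduct (fun x y => -br x y) x y z = tripleProduct br x y z := by
    simp [tripleProduct, hl, hr]
  have e' : pairYamagutian T S x y = pairYamagutian S T x y := by
    rw [pairYamagutian, pairYamagutian, h.mixed]; module
  rwa [e, e'] at key

/-- The derivation `6 ad Y` acts on the values of `S` and of `T` through the same map of `V`, and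
the second Yamagutian is built from brackets of such values, so the Leibniz rule suffices. -/
theorem lie_yamagutian_yamagutian (hl : ∀ x y, br x (-y) = -br x y)
    (hr : ∀ x y, br (-x) y = -br x y) (x y z w : V) :
    (6 : ℝ) • ⁅pairYamagutian S T x y, pairYamagutian S T z w⁆
      = pairYamagutian S T (tripleProduct br x y z) w
        + pairYamagutian S T z (tripleProduct br x y w) := by
  have hS := h.lie_yamagutian_left x y
  have hT := h.lie_yamagutian_right hl hr x y
  generalize pairYamagutian S T x y = Y at hS hT ⊢
  simp only [pairYamagutian, ← hS, ← hT]
  simp only [lie_add, lie_smul, smul_lie, leibniz_lie Y]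
  module

theorem yamagutian_self (x : V) : pairYamagutian S T x x = 0 := by
  have := h.mixed_swap x x
  have h0 : ⁅S x, T x⁆ = 0 := by
    linear_combination (norm := module) (1 / 2 : ℝ) • this
  simp [pairYamagutian, h0]

theorem yamagutian_skew (x y : V) : pairYamagutian S T y x = -pairYamagutian S T x y := by
  rw [pairYamagutian, pairYamagutian, h.mixed_swap y x, ← lie_skew (S y), ← lie_skew (T y)]
  module

end IsTrialityPair

/-- The span of the values of a pair of maps and of their Yamagutian. -/
noncomputable def pairSpan (S T : V →ₗ[ℝ] L) : Submodule ℝ L :=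
  Submodule.span ℝ (Set.range S ∪ Set.range T ∪ {A | ∃ x y, A = pairYamagutian S T x y})

section pairSpan

variable (S T : V →ₗ[ℝ] L)

theorem left_mem_pairSpan (x : V) : S x ∈ pairSpan S T :=
  Submodule.subset_span (Or.inl (Or.inl ⟨x, rfl⟩))

theorem right_mem_pairSpan (x : V) : T x ∈ pairSpan S T :=
  Submodule.subset_span (Or.inl (Or.inr ⟨x, rfl⟩))

theorem yamagutian_mem_pairSpan (x y : V) : pairYamagutian S T x y ∈ pairSpan S T :=
  Submodule.subset_span (Or.inr ⟨x, y, rfl⟩)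

end pairSpan

namespace IsTrialityPair

variable {br : V → V → V} {S T : V →ₗ[ℝ] L} (h : IsTrialityPair br S T)
include h

theorem lie_mem_pairSpan (hl : ∀ x y, br x (-y) = -br x y) (hr : ∀ x y, br (-x) y = -br x y)
    {A B : L} (hA : A ∈ pairSpan S T) (hB : B ∈ pairSpan S T) : ⁅A, B⁆ ∈ pairSpan S T := by
  have mS := left_mem_pairSpan S T
  have mT := right_mem_pairSpan S T
  have mY := yamagutian_mem_pairSpan S T
  have hST (x y : V) : ⁅S x, T y⁆ ∈ pairSpan S T := by
    rw [h.lie_left_right]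
    exact sub_mem (add_mem (neg_mem (mY _ _)) (Submodule.smul_mem _ _ (mS _)))
      (Submodule.smul_mem _ _ (mT _))
  have six {u v : L} (e : (6 : ℝ) • u = v) (hv : v ∈ pairSpan S T) : u ∈ pairSpan S T := by
    rw [← e] at hv
    exact (Submodule.smul_mem_iff _ (by norm_num)).mp hv
  have hYS (x y z : V) : ⁅pairYamagutian S T x y, S z⁆ ∈ pairSpan S T :=
    six (h.lie_yamagutian_left x y z) (mS _)
  have hYT (x y z : V) : ⁅pairYamagutian S T x y, T z⁆ ∈ pairSpan S T :=
    six (h.lie_yamagutian_right hl hr x y z) (mT _)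
  have skew {u v : L} (e : ⁅u, v⁆ ∈ pairSpan S T) : ⁅v, u⁆ ∈ pairSpan S T := by
    rw [← lie_skew]; exact neg_mem e
  refine Submodule.span_induction₂ (p := fun u v _ _ => ⁅u, v⁆ ∈ pairSpan S T) ?_ ?_ ?_ ?_ ?_ ?_ ?_
    hA hB
  · rintro u v ((⟨x, rfl⟩ | ⟨x, rfl⟩) | ⟨x, y, rfl⟩) ((⟨z, rfl⟩ | ⟨z, rfl⟩) | ⟨z, w, rfl⟩)
    · rw [h.lie_left_left]
      exact add_mem (add_mem (Submodule.smul_mem _ _ (mY _ _)) (Submodule.smul_mem _ _ (mS _)))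
        (Submodule.smul_mem _ _ (mT _))
    · exact hST x z
    · exact skew (hYS _ _ _)
    · exact skew (hST _ _)
    · rw [h.lie_right_right]
      exact sub_mem (sub_mem (Submodule.smul_mem _ _ (mY _ _)) (Submodule.smul_mem _ _ (mS _)))
        (Submodule.smul_mem _ _ (mT _))
    · exact skew (hYT _ _ _)
    · exact hYS _ _ _
    · exact hYT _ _ _
    · exact six (h.lie_yamagutian_yamagutian hl hr x y z w) (add_mem (mY _ _) (mY _ _))
  · intro y _; simp
  · intro x _; simp
  · intro x y z _ _ _ hx hy; rw [add_lie]; exact add_mem hx hy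
  · intro x y z _ _ _ hx hy; rw [lie_add]; exact add_mem hx hy
  · intro c x y _ _ hx; rw [smul_lie]; exact Submodule.smul_mem _ _ hx
  · intro c x y _ _ hx; rw [lie_smul]; exact Submodule.smul_mem _ _ hx

/-- The Yamagutian is bilinear and alternating, so pairs of basis vectors with `i < j` suffice; the
values of `S` and `T` on the basis contribute the remaining `2r` generators. -/
theorem finrank_pairSpan_le {r : ℕ} (b : Module.Basis (Fin r) ℝ V) :
    Module.finrank ℝ (pairSpan S T) ≤ 2 * r + r * (r - 1) / 2 := by
  classical
  let P := {p : Fin r × Fin r // p.1 < p.2}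
  let f : (Fin r ⊕ Fin r) ⊕ P → L :=
    Sum.elim (Sum.elim (fun i => S (b i)) (fun i => T (b i)))
      (fun p => pairYamagutian S T (b p.1.1) (b p.1.2))
  have hf (i) : f i ∈ Submodule.span ℝ (Set.range f) := Submodule.subset_span ⟨i, rfl⟩
  have hP : Fintype.card P = r * (r - 1) / 2 := by
    have e : Fintype.card P = ((Finset.univ : Finset (Fin r × Fin r)).filter
        (fun p => p.1 < p.2)).card := Fintype.card_subtype _
    rw [e, ← Finset.sum_range_id_mul_two r, Nat.mul_div_cancel _ two_pos]
    rw [Finset.card_filter, ← Finset.univ_product_univ, Finset.sum_product_right,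
      ← Fin.sum_univ_eq_sum_range (fun i => i)]
    refine Finset.sum_congr rfl fun j _ => ?_
    rw [← Finset.card_filter]
    exact (congrArg Finset.card (by ext; simp)).trans (Fin.card_Iio j)
  have key : pairSpan S T ≤ Submodule.span ℝ (Set.range f) := by
    refine Submodule.span_le.mpr ?_
    rintro A ((⟨x, rfl⟩ | ⟨x, rfl⟩) | ⟨x, y, rfl⟩)
    · rw [← b.sum_repr x, map_sum]
      exact Submodule.sum_mem _ fun i _ => by
        rw [map_smul]; exact Submodule.smul_mem _ _ (hf (.inl (.inl i)))
    · rw [← b.sum_repr x, map_sum]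
      exact Submodule.sum_mem _ fun i _ => by
        rw [map_smul]; exact Submodule.smul_mem _ _ (hf (.inl (.inr i)))
    · have hb (i j : Fin r) : pairYamagutian S T (b i) (b j) ∈ Submodule.span ℝ (Set.range f) := by
        rcases lt_trichotomy i j with hij | rfl | hij
        · exact hf (.inr ⟨(i, j), hij⟩)
        · rw [h.yamagutian_self]; exact zero_mem _
        · rw [h.yamagutian_skew]; exact neg_mem (hf (.inr ⟨(j, i), hij⟩))
      have e : pairYamagutian S T x y = ∑ i, ∑ j, (b.repr x i * b.repr y j) •
          pairYamagutian S T (b i) (b j) := by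
        conv_lhs => rw [← b.sum_repr x, ← b.sum_repr y]
        simp only [pairYamagutian, map_sum, map_smul, sum_lie_sum, smul_lie,
          lie_smul, smul_add, Finset.smul_sum, Finset.sum_add_distrib, smul_smul, mul_comm]
      rw [e]
      exact Submodule.sum_mem _ fun i _ => Submodule.sum_mem _ fun j _ =>
        Submodule.smul_mem _ _ (hb i j)
  have hfin : FiniteDimensional ℝ (Submodule.span ℝ (Set.range f)) :=
    FiniteDimensional.span_of_finite ℝ (Set.finite_range f)
  calc Module.finrank ℝ (pairSpan S T) ≤ Module.finrank ℝ (Submodule.span ℝ (Set.range f)) :=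
        Submodule.finrank_mono key
    _ ≤ Fintype.card ((Fin r ⊕ Fin r) ⊕ P) := finrank_range_le_card f
    _ = 2 * r + r * (r - 1) / 2 := by
        rw [Fintype.card_sum, Fintype.card_sum, hP, Fintype.card_fin]; ring

end IsTrialityPair

end Triality

/-! ### Velocities of curves in a group of units -/

section Velocity

open NormedSpace

variable {𝔸 : Type*} [NormedRing 𝔸] [NormedAlgebra ℝ 𝔸] [CompleteSpace 𝔸]

/-- The one-parameter group of units generated by an element of a Banach algebra. -/
noncomputable def oneParam (X : 𝔸) (t : ℝ) : 𝔸ˣ :=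
  letI := NormedAlgebra.restrictScalars ℚ ℝ 𝔸
  { val := exp (t • X)
    inv := exp ((-t) • X)
    val_inv := by
      rw [← exp_add_of_commute (((Commute.refl X).smul_left _).smul_right _), ← add_smul]; simp
    inv_val := by
      rw [← exp_add_of_commute (((Commute.refl X).smul_left _).smul_right _), ← add_smul]; simp }

theorem coe_oneParam (X : 𝔸) (t : ℝ) : (oneParam X t : 𝔸) = exp (t • X) := rfl

theorem oneParam_zero (X : 𝔸) : oneParam X 0 = 1 := by
  ext; simp [coe_oneParam]

theorem oneParam_neg (X : 𝔸) (t : ℝ) : oneParam X (-t) = (oneParam X t)⁻¹ :=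
  Units.ext rfl

theorem hasDerivAt_oneParam (X : 𝔸) (t : ℝ) :
    HasDerivAt (fun t => (oneParam X t : 𝔸)) (oneParam X t * X) t :=
  hasDerivAt_exp_smul_const X t

theorem hasDerivAt_oneParam' (X : 𝔸) (t : ℝ) :
    HasDerivAt (fun t => (oneParam X t : 𝔸)) (X * oneParam X t) t :=
  hasDerivAt_exp_smul_const' X t

theorem hasDerivAt_inv_oneParam (X : 𝔸) (t : ℝ) :
    HasDerivAt (fun t => (((oneParam X t)⁻¹ : 𝔸ˣ) : 𝔸)) (-(((oneParam X t)⁻¹ : 𝔸ˣ) * X)) t := by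
  have := (hasDerivAt_oneParam X (-t)).scomp t (hasDerivAt_neg t)
  simpa using! this

theorem continuous_oneParam (X : 𝔸) : Continuous (oneParam X) := by
  rw [Units.continuous_iff]
  exact ⟨continuous_iff_continuousAt.mpr fun t => (hasDerivAt_oneParam X t).continuousAt,
    continuous_iff_continuousAt.mpr fun t => (hasDerivAt_inv_oneParam X t).continuousAt⟩

theorem contDiff_oneParam (X : 𝔸) {k : ℕ∞ω} : ContDiff ℝ k (fun t => (oneParam X t : 𝔸)) := by
  have h1 : ContDiff ℝ ω (exp : 𝔸 → 𝔸) :=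
    contDiff_iff_contDiffAt.mpr fun x => (exp_analytic (𝕂 := ℝ) x).contDiffAt
  exact (h1.comp (contDiff_id.smul contDiff_const)).of_le le_top

omit [CompleteSpace 𝔸] in
theorem eventually_eq_of_hasDerivAt_zero {f : ℝ → 𝔸}
    (hf : ∀ᶠ t in 𝓝 (0 : ℝ), HasDerivAt f 0 t) : ∀ᶠ t in 𝓝 (0 : ℝ), f t = f 0 := by
  obtain ⟨ε, hε, hball⟩ := Metric.eventually_nhds_iff_ball.mp hf
  refine Metric.eventually_nhds_iff_ball.mpr ⟨ε, hε, fun t ht => ?_⟩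
  refine (convex_ball (0 : ℝ) ε).is_const_of_fderivWithin_eq_zero (𝕜 := ℝ)
    (fun s hs => (hball s hs).differentiableAt.differentiableWithinAt)
    (fun s hs => ?_) ht (Metric.mem_ball_self hε)
  rw [fderivWithin_of_isOpen Metric.isOpen_ball hs]
  ext
  simpa using (hball s hs).deriv

/-- The solution of `a' = X a` with initial value `1` is the one-parameter group of `X`. -/
theorem eventually_eq_oneParam {a : ℝ → 𝔸} {X : 𝔸} (h0 : a 0 = 1)
    (ha : ∀ᶠ t in 𝓝 (0 : ℝ), HasDerivAt a (X * a t) t) :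
    ∀ᶠ t in 𝓝 (0 : ℝ), a t = oneParam X t := by
  have h1 : ∀ᶠ t in 𝓝 (0 : ℝ), HasDerivAt (fun s => ((oneParam X s)⁻¹ : 𝔸ˣ) * a s) 0 t := by
    filter_upwards [ha] with t ht
    convert (hasDerivAt_inv_oneParam X t).fun_mul ht using 1
    rw [neg_mul, mul_assoc, neg_add_cancel]
  filter_upwards [eventually_eq_of_hasDerivAt_zero h1] with t ht
  simp only [h0, oneParam_zero, inv_one, Units.val_one, mul_one] at ht
  rw [← Units.mul_inv_cancel_left (oneParam X t) (a t), ht, mul_one]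

/-- The solution of `a' = a X` with initial value `1` is the one-parameter group of `X`. -/
theorem eventually_eq_oneParam' {a : ℝ → 𝔸} {X : 𝔸} (h0 : a 0 = 1)
    (ha : ∀ᶠ t in 𝓝 (0 : ℝ), HasDerivAt a (a t * X) t) :
    ∀ᶠ t in 𝓝 (0 : ℝ), a t = oneParam X t := by
  have h1 : ∀ᶠ t in 𝓝 (0 : ℝ), HasDerivAt (fun s => a s * ((oneParam X s)⁻¹ : 𝔸ˣ)) 0 t := by
    filter_upwards [ha] with t ht
    -- The left and right derivative formulas describe the same derivative, hence `X` commutes with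
    -- its one-parameter group.
    have hc : Commute X (((oneParam X t)⁻¹ : 𝔸ˣ) : 𝔸) := Commute.units_inv_right
      ((hasDerivAt_oneParam' X t).unique (hasDerivAt_oneParam X t))
    convert ht.fun_mul (hasDerivAt_inv_oneParam X t) using 1
    rw [mul_assoc, hc.eq, mul_neg, add_neg_cancel]
  filter_upwards [eventually_eq_of_hasDerivAt_zero h1] with t ht
  simp only [h0, oneParam_zero, inv_one, Units.val_one, mul_one] at ht
  exact Units.mul_inv_eq_one.mp ht

/-- The velocities at the identity of the `C^1` curves in a subgroup of the units. -/
def velocitySet (H : Subgroup 𝔸ˣ) : Set 𝔸 :=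
  {X | ∃ γ : ℝ → 𝔸, γ 0 = 1 ∧ (∀ᶠ t in 𝓝 (0 : ℝ), ∃ h ∈ H, (h : 𝔸) = γ t) ∧
    ContDiffAt ℝ 1 γ 0 ∧ HasDerivAt γ X 0}

omit [CompleteSpace 𝔸] in
theorem velocitySet_mono {H K : Subgroup 𝔸ˣ} (h : H ≤ K) : velocitySet H ⊆ velocitySet K := by
  rintro X ⟨γ, h0, hγ, hc⟩
  exact ⟨γ, h0, hγ.mono fun t ⟨u, hu, e⟩ => ⟨u, h hu, e⟩, hc⟩

/-- The velocities at the identity of the curves in a subgroup of the units form a subspace. -/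
def velocitySubmodule (H : Subgroup 𝔸ˣ) : Submodule ℝ 𝔸 where
  carrier := velocitySet H
  zero_mem' := ⟨fun _ => 1, rfl, .of_forall fun _ => ⟨1, one_mem H, rfl⟩, contDiffAt_const,
    hasDerivAt_const _ _⟩
  add_mem' := by
    rintro X Y ⟨γ, h0, hγ, hc, hd⟩ ⟨δ, k0, hδ, kc, kd⟩
    refine ⟨fun t => γ t * δ t, by simp [h0, k0], ?_, hc.mul kc, ?_⟩
    · filter_upwards [hγ, hδ] with t ⟨u, hu, e⟩ ⟨v, hv, e'⟩
      exact ⟨u * v, mul_mem hu hv, by simp [e, e']⟩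
    · simpa [h0, k0] using hd.fun_mul kd
  smul_mem' := by
    rintro c X ⟨γ, h0, hγ, hc, hd⟩
    have e0 : c * (0 : ℝ) = 0 := mul_zero c
    refine ⟨fun t => γ (c * t), by simp [h0], ?_, ?_, ?_⟩
    · have : Filter.Tendsto (fun t : ℝ => c * t) (𝓝 0) (𝓝 0) := by
        simpa using (continuous_const_mul c).tendsto (0 : ℝ)
      exact this.eventually hγ
    · exact ContDiffAt.comp (0 : ℝ) (by rwa [e0]) (contDiff_const.mul contDiff_id).contDiffAt
    · have h1 : HasDerivAt (fun t : ℝ => c * t) c 0 := by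
        simpa using (hasDerivAt_id (0 : ℝ)).const_mul c
      exact HasDerivAt.scomp (0 : ℝ) (by rwa [e0]) h1

omit [CompleteSpace 𝔸] in
theorem conj_mem_velocitySubmodule {H : Subgroup 𝔸ˣ} {u : 𝔸ˣ} (hu : u ∈ H) {X : 𝔸}
    (hX : X ∈ velocitySubmodule H) : (u : 𝔸) * X * ((u⁻¹ : 𝔸ˣ) : 𝔸) ∈ velocitySubmodule H := by
  obtain ⟨γ, h0, hγ, hc, hd⟩ := hX
  refine ⟨fun t => u * γ t * ((u⁻¹ : 𝔸ˣ) : 𝔸), by simp [h0], ?_,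
    (contDiffAt_const.mul hc).mul contDiffAt_const, (hd.const_mul _).mul_const _⟩
  filter_upwards [hγ] with t ⟨v, hv, e⟩
  exact ⟨u * v * u⁻¹, mul_mem (mul_mem hu hv) (inv_mem hu), by simp [e]⟩

theorem mem_velocitySubmodule_of_oneParam {H : Subgroup 𝔸ˣ} {X : 𝔸}
    (h : ∀ᶠ t in 𝓝 (0 : ℝ), oneParam X t ∈ H) : X ∈ velocitySubmodule H :=
  ⟨fun t => oneParam X t, by simp [oneParam_zero], h.mono fun t ht => ⟨_, ht, rfl⟩,
    (contDiff_oneParam X).contDiffAt, by simpa [oneParam_zero] using hasDerivAt_oneParam X 0⟩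

variable [FiniteDimensional ℝ 𝔸]

omit [CompleteSpace 𝔸] in
/-- Every subspace of a finite-dimensional algebra is the kernel of a continuous projection. -/
theorem Submodule.exists_continuous_projection_ker (V : Submodule ℝ 𝔸) :
    ∃ p : 𝔸 →L[ℝ] 𝔸, (∀ x, p x = 0 ↔ x ∈ V) ∧ ∀ x, p (p x) = p x := by
  obtain ⟨W, hW⟩ := V.exists_isCompl
  refine ⟨LinearMap.toContinuousLinearMap (W.projection V hW.symm), fun x => ?_, fun x => ?_⟩
  · exact Submodule.projection_apply_eq_zero_iff hW.symm
  · exact Submodule.projection_apply_of_mem_left hW.symm (Submodule.projection_apply_mem _ _)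

-- The subspace is the kernel of a continuous linear map, which can be applied to the derivative.
omit [CompleteSpace 𝔸] in
theorem HasDerivAt.mem_of_eventually_mem {V : Submodule ℝ 𝔸} {f : ℝ → 𝔸} {f' : 𝔸} {t : ℝ}
    (hf : HasDerivAt f f' t) (h : ∀ᶠ s in 𝓝 t, f s ∈ V) : f' ∈ V := by
  obtain ⟨p, hp, -⟩ := V.exists_continuous_projection_ker
  have h1 : HasDerivAt (fun s => p (f s)) (p f') t := p.hasFDerivAt.comp_hasDerivAt t hf
  have h2 : (fun s => p (f s)) =ᶠ[𝓝 t] fun _ => 0 := h.mono fun s hs => (hp _).mpr hs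
  exact (hp _).mp (h1.unique ((hasDerivAt_const t (0 : 𝔸)).congr_of_eventuallyEq h2))

/-- If `γ` is a curve in `H` with velocity `X`, then `γ(t) Y γ(t)⁻¹` stays in the velocity space,
and its derivative at `0` is `[X, Y]`. -/
theorem lie_mem_velocitySubmodule {H : Subgroup 𝔸ˣ} {X Y : 𝔸} (hX : X ∈ velocitySubmodule H)
    (hY : Y ∈ velocitySubmodule H) : ⁅X, Y⁆ ∈ velocitySubmodule H := by
  obtain ⟨γ, h0, hγ, -, hd⟩ := hX
  have hi : HasDerivAt (fun t => Ring.inverse (γ t)) (-X) 0 := by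
    have := hasFDerivAt_ringInverse (𝕜 := ℝ) (1 : 𝔸ˣ)
    rw [Units.val_one, ← h0] at this
    simpa using! this.comp_hasDerivAt 0 hd
  have key := (hd.mul_const Y).fun_mul hi
  have e : X * Y * Ring.inverse (γ 0) + γ 0 * Y * -X = ⁅X, Y⁆ := by
    simp [h0, Ring.lie_def, sub_eq_add_neg]
  rw [e] at key
  refine key.mem_of_eventually_mem ?_
  filter_upwards [hγ] with t ⟨u, hu, e⟩
  simpa [← e] using! conj_mem_velocitySubmodule hu hY

/-- A subspace stable under `ad X` is stable under conjugation by `exp (t X)`. -/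
theorem conj_oneParam_mem {V : Submodule ℝ 𝔸} {X : 𝔸} (hX : ∀ Y ∈ V, ⁅X, Y⁆ ∈ V) {Y : 𝔸}
    (hY : Y ∈ V) (t : ℝ) :
    (oneParam X t : 𝔸) * Y * ((oneParam X t)⁻¹ : 𝔸ˣ) ∈ V := by
  obtain ⟨p, hp, hpp⟩ := V.exists_continuous_projection_ker
  let g : ℝ → 𝔸 := fun t => (oneParam X t : 𝔸) * Y * ((oneParam X t)⁻¹ : 𝔸ˣ)
  let A : 𝔸 →L[ℝ] 𝔸 := p ∘L (ContinuousLinearMap.mul ℝ 𝔸 X - (ContinuousLinearMap.mul ℝ 𝔸).flip X)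
  have hA (Z : 𝔸) : A Z = p ⁅X, Z⁆ := rfl
  have hg (t : ℝ) : HasDerivAt g ⁅X, g t⁆ t := by
    convert ((hasDerivAt_oneParam' X t).mul_const Y).fun_mul (hasDerivAt_inv_oneParam X t) using 1
    simp only [g, Ring.lie_def, mul_assoc, mul_neg, sub_eq_add_neg]
  -- Since `g - p g` lies in `V` and `ad X` preserves `V`, `p g` satisfies a linear equation of its
  -- own. It starts at `0`, so uniqueness makes it vanish.
  have hu (t : ℝ) : HasDerivAt (fun t => p (g t)) (A (p (g t))) t := by
    have h1 := p.hasFDerivAt.comp_hasDerivAt t (hg t)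
    have h2 : g t - p (g t) ∈ V := (hp _).mp (by rw [map_sub, hpp, sub_self])
    have h3 := (hp _).mpr (hX _ h2)
    have h4 : ⁅X, g t - p (g t)⁆ = ⁅X, g t⁆ - ⁅X, p (g t)⁆ := by
      simp only [Ring.lie_def]; noncomm_ring
    rw [h4, map_sub, sub_eq_zero] at h3
    rw [hA, ← h3]
    exact h1
  have key := ODE_solution_unique_univ (v := fun _ => A) (s := fun _ => Set.univ) (K := ‖A‖₊)
    (f := fun t => p (g t)) (g := fun _ => 0) (t₀ := 0)
    (fun _ => A.lipschitz.lipschitzOnWith) (fun t => ⟨hu t, trivial⟩)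
    (fun t => ⟨by simpa using hasDerivAt_const t (0 : 𝔸), trivial⟩)
    (by simpa [g, oneParam_zero] using (hp Y).mpr hY)
  exact (hp _).mp (congrFun key t)

end Velocity

/-! ### The subgroup generated by the exponentials of a Lie algebra of matrices -/

section Leaf

variable {𝔸 : Type*} [NormedRing 𝔸] [NormedAlgebra ℝ 𝔸] [CompleteSpace 𝔸]

/-- Coordinates of the second kind: an ordered product of one-parameter groups whose parameters
are linear forms. -/
noncomputable def expProd {P : Type*} [NormedAddCommGroup P] [NormedSpace ℝ P]
    (l : List ((P →L[ℝ] ℝ) × 𝔸)) (c : P) : 𝔸ˣ :=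
  (l.map fun q => oneParam q.2 (q.1 c)).prod

section expProd

variable {P : Type*} [NormedAddCommGroup P] [NormedSpace ℝ P]

@[simp] theorem expProd_nil (c : P) : expProd ([] : List ((P →L[ℝ] ℝ) × 𝔸)) c = 1 := rfl

@[simp] theorem expProd_cons (q : (P →L[ℝ] ℝ) × 𝔸) (l : List ((P →L[ℝ] ℝ) × 𝔸)) (c : P) :
    expProd (q :: l) c = oneParam q.2 (q.1 c) * expProd l c := by
  simp [expProd]

theorem expProd_zero (l : List ((P →L[ℝ] ℝ) × 𝔸)) : expProd l 0 = 1 := by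
  induction l with
  | nil => rfl
  | cons q l ih => simp [ih, oneParam_zero]

theorem contDiff_expProd (l : List ((P →L[ℝ] ℝ) × 𝔸)) {k : ℕ∞ω} :
    ContDiff ℝ k (fun c => (expProd l c : 𝔸)) := by
  induction l with
  | nil => exact contDiff_const
  | cons q l ih =>
    simp only [expProd_cons, Units.val_mul]
    exact ((contDiff_oneParam q.2).comp q.1.contDiff).mul ih

theorem hasFDerivAt_expProd_zero (l : List ((P →L[ℝ] ℝ) × 𝔸)) :
    HasFDerivAt (fun c => (expProd l c : 𝔸)) (l.map fun q => q.1.smulRight q.2).sum 0 := by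
  induction l with
  | nil => exact hasFDerivAt_const (1 : 𝔸) (0 : P)
  | cons q l ih =>
    have h1 : HasFDerivAt (fun c : P => (oneParam q.2 (q.1 c) : 𝔸)) (q.1.smulRight q.2) 0 := by
      have h2 := HasFDerivAt.comp (0 : P) (hasDerivAt_oneParam q.2 (q.1 0)).hasFDerivAt
        q.1.hasFDerivAt
      refine h2.congr_fderiv ?_
      ext; simp [oneParam_zero]
    have := h1.fun_mul' ih
    simpa [expProd_zero, oneParam_zero, add_comm] using! this

/-- The logarithmic derivative of `expProd` takes its values in any subspace which contains the
exponents and is stable under commutators. -/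
theorem hasFDerivAt_expProd [FiniteDimensional ℝ 𝔸] {V : Submodule ℝ 𝔸}
    (hV : ∀ X ∈ V, ∀ Y ∈ V, ⁅X, Y⁆ ∈ V)
    (l : List ((P →L[ℝ] ℝ) × 𝔸)) (hl : ∀ q ∈ l, q.2 ∈ V) (c : P) :
    (∀ Y ∈ V, (((expProd l c)⁻¹ : 𝔸ˣ) : 𝔸) * Y * expProd l c ∈ V) ∧
    ∃ D : P →L[ℝ] 𝔸, HasFDerivAt (fun c => (expProd l c : 𝔸)) D c ∧
      ∀ v, ∃ Y ∈ V, D v = expProd l c * Y := by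
  induction l with
  | nil =>
    exact ⟨fun Y hY => by simpa using hY, 0, hasFDerivAt_const (1 : 𝔸) c,
      fun v => ⟨0, zero_mem _, by simp⟩⟩
  | cons q l ih =>
    obtain ⟨hc, D, hD, hDV⟩ := ih fun q hq => hl q (List.mem_cons_of_mem _ hq)
    have hq : q.2 ∈ V := hl q List.mem_cons_self
    refine ⟨fun Y hY => ?_, ?_⟩
    · have h1 := conj_oneParam_mem (fun Z hZ => hV _ hq Z hZ) hY (-(q.1 c))
      rw [oneParam_neg, inv_inv] at h1
      simpa [mul_assoc] using hc _ h1
    · have h1 : HasFDerivAt (fun c : P => (oneParam q.2 (q.1 c) : 𝔸))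
          (q.1.smulRight (oneParam q.2 (q.1 c) * q.2)) c := by
        refine (HasFDerivAt.comp c (hasDerivAt_oneParam q.2 (q.1 c)).hasFDerivAt
          q.1.hasFDerivAt).congr_fderiv ?_
        ext; simp
      have h2 := h1.fun_mul' hD
      simp only [expProd_cons, Units.val_mul]
      refine ⟨_, h2, fun v => ?_⟩
      obtain ⟨Y, hY, e⟩ := hDV v
      -- Pulling the new exponent to the right of the remaining product conjugates it, which keeps
      -- it in `V`.
      refine ⟨Y + (q.1 v) • (((expProd l c)⁻¹ : 𝔸ˣ) * q.2 * expProd l c),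
        add_mem hY (Submodule.smul_mem _ _ (hc _ hq)), ?_⟩
      simp [e, mul_add, mul_assoc]

end expProd

variable [FiniteDimensional ℝ 𝔸]

/-- A Lie subalgebra `V` of a finite-dimensional algebra has a local first integral: a function
near the identity which is constant in the directions `a V` and whose differential at the
identity has kernel in `V`. -/
theorem exists_firstIntegral {V : Submodule ℝ 𝔸} (hV : ∀ X ∈ V, ∀ Y ∈ V, ⁅X, Y⁆ ∈ V) :
    ∃ w : 𝔸 → 𝔸,
      (∀ᶠ a in 𝓝 (1 : 𝔸), ∃ D : 𝔸 →L[ℝ] 𝔸, HasFDerivAt w D a ∧ ∀ Y ∈ V, D (a * Y) = 0) ∧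
      ∃ D : 𝔸 →L[ℝ] 𝔸, HasFDerivAt w D 1 ∧ ∀ X, D X = 0 → X ∈ V := by
  obtain ⟨W, hW⟩ := V.exists_isCompl
  let b := Module.finBasis ℝ V
  let l : List ((V →L[ℝ] ℝ) × 𝔸) :=
    List.ofFn fun i => (LinearMap.toContinuousLinearMap (b.coord i), (b i : 𝔸))
  have hl : ∀ q ∈ l, q.2 ∈ V := by
    intro q hq
    obtain ⟨i, rfl⟩ := (List.mem_ofFn' _ _).mp hq
    exact (b i).2
  let E : V → 𝔸ˣ := expProd l
  have hE0 : HasFDerivAt (fun c => (E c : 𝔸)) V.subtypeL 0 := by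
    have h1 := hasFDerivAt_expProd_zero l
    have e : (l.map fun q => q.1.smulRight q.2).sum = V.subtypeL := by
      ext c
      simp only [l, List.map_ofFn, List.sum_ofFn]
      have : ((∑ i, b.repr c i • b i : V) : 𝔸) = c := by rw [b.sum_repr]
      simpa [-Module.Basis.sum_repr] using this
    rwa [e] at h1
  -- Its differential at `0` is `(w, c) ↦ w + c`, so `Φ` is a local chart. Its slices with fixed `w`
  -- are tangent to the spaces `aV`; the `W`-coordinate of the inverse is therefore the required
  -- first integral.
  let Φ : W × V → 𝔸 := fun q => (1 + (q.1 : 𝔸)) * E q.2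
  have hΦc : ContDiff ℝ 1 Φ :=
    (contDiff_const.add (W.subtypeL.contDiff.comp contDiff_fst)).mul
      ((contDiff_expProd l).comp contDiff_snd)
  let e := (W.prodEquivOfIsCompl V hW.symm).toContinuousLinearEquiv
  have hΦ0 : HasFDerivAt Φ (e : W × V →L[ℝ] 𝔸) 0 := by
    have h1 : HasFDerivAt (fun q : W × V => 1 + (q.1 : 𝔸))
        (W.subtypeL ∘L ContinuousLinearMap.fst ℝ W V) 0 :=
      (W.subtypeL ∘L ContinuousLinearMap.fst ℝ W V).hasFDerivAt.const_add 1
    have h2 : HasFDerivAt (fun q : W × V => (E q.2 : 𝔸))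
        (V.subtypeL ∘L ContinuousLinearMap.snd ℝ W V) 0 :=
      HasFDerivAt.comp (0 : W × V) (g := fun c => (E c : 𝔸)) hE0
        (ContinuousLinearMap.snd ℝ W V).hasFDerivAt
    have h3 := h1.fun_mul' h2
    have e0 : (E 0) = 1 := expProd_zero l
    refine h3.congr_fderiv ?_
    ext q <;> simp [e, e0]
  have hΦ1 : Φ 0 = 1 := by
    have e0 : (E 0) = 1 := expProd_zero l
    simp [Φ, e0]
  let Ψ := hΦc.contDiffAt.localInverse hΦ0 one_ne_zero
  have hΨ : ContDiffAt ℝ 1 Ψ 1 := by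
    have := hΦc.contDiffAt.to_localInverse hΦ0 one_ne_zero
    rwa [hΦ1] at this
  have hΨ1 : Ψ 1 = 0 := by
    have := hΦc.contDiffAt.localInverse_apply_image hΦ0 one_ne_zero
    rwa [hΦ1] at this
  have hstr := hΦc.contDiffAt.hasStrictFDerivAt' hΦ0 one_ne_zero
  have hR : ∀ᶠ a in 𝓝 (1 : 𝔸), Φ (Ψ a) = a := by
    have := hstr.eventually_right_inverse
    rwa [hΦ1] at this
  have hL : ∀ᶠ q in 𝓝 (0 : W × V), Ψ (Φ q) = q := hstr.eventually_left_inverse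
  -- The identity is needed on a whole neighbourhood of `Ψ a`, because it is differentiated there.
  have hL' : ∀ᶠ a in 𝓝 (1 : 𝔸), ∀ᶠ q in 𝓝 (Ψ a), Ψ (Φ q) = q := by
    have h1 := hΨ.continuousAt.tendsto
    rw [hΨ1] at h1
    exact h1.eventually hL.eventually_nhds
  have hd : ∀ᶠ a in 𝓝 (1 : 𝔸), DifferentiableAt ℝ Ψ a :=
    (hΨ.eventually (by simp)).mono fun a ha => ha.differentiableAt one_ne_zero
  let pr : W × V →L[ℝ] 𝔸 := W.subtypeL ∘L ContinuousLinearMap.fst ℝ W V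
  refine ⟨fun a => pr (Ψ a), ?_, ?_⟩
  · filter_upwards [hR, hL', hd] with a haR haL had
    refine ⟨pr ∘L fderiv ℝ Ψ a, pr.hasFDerivAt.comp a had.hasFDerivAt, fun Y hY => ?_⟩
    have hF : HasFDerivAt Φ (fderiv ℝ Φ (Ψ a)) (Ψ a) :=
      (hΦc.differentiable one_ne_zero _).hasFDerivAt
    have hDF : (fderiv ℝ Ψ a) ∘L (fderiv ℝ Φ (Ψ a)) = ContinuousLinearMap.id ℝ _ := by
      have h1 : HasFDerivAt Ψ (fderiv ℝ Ψ a) (Φ (Ψ a)) := by rw [haR]; exact had.hasFDerivAt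
      exact (h1.comp (Ψ a) hF).unique
        ((hasFDerivAt_id (Ψ a)).congr_of_eventuallyEq haL)
    obtain ⟨-, D, hD, hDV⟩ := hasFDerivAt_expProd hV l hl (Ψ a).2
    let u : 𝔸ˣ := E (Ψ a).2
    have hmem (c : V) : ((u⁻¹ : 𝔸ˣ) : 𝔸) * D c ∈ V := by
      obtain ⟨Z, hZ, eZ⟩ := hDV c
      have : ((u⁻¹ : 𝔸ˣ) : 𝔸) * D c = Z := by rw [eZ]; exact Units.inv_mul_cancel_left u Z
      rwa [this]
    let y : V →ₗ[ℝ] V := LinearMap.codRestrict V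
      ((LinearMap.mulLeft ℝ ((u⁻¹ : 𝔸ˣ) : 𝔸)) ∘ₗ D.toLinearMap) hmem
    have hFy (c : V) : fderiv ℝ Φ (Ψ a) (0, c) = a * y c := by
      have h1 : HasFDerivAt (fun q : W × V => 1 + (q.1 : 𝔸))
          (W.subtypeL ∘L ContinuousLinearMap.fst ℝ W V) (Ψ a) :=
        (W.subtypeL ∘L ContinuousLinearMap.fst ℝ W V).hasFDerivAt.const_add 1
      have h2 : HasFDerivAt (fun q : W × V => (E q.2 : 𝔸))
          (D ∘L ContinuousLinearMap.snd ℝ W V) (Ψ a) :=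
        HasFDerivAt.comp (Ψ a) (g := fun c => (E c : 𝔸)) hD
          (ContinuousLinearMap.snd ℝ W V).hasFDerivAt
      have h3 := hF.unique (h1.fun_mul' h2)
      have hyc : (y c : 𝔸) = ((u⁻¹ : 𝔸ˣ) : 𝔸) * D c := rfl
      rw [h3, hyc]
      conv_rhs => rw [← haR]
      simp [Φ, u, mul_assoc]
    -- Being an injective endomorphism of the finite-dimensional `V`, `y` is onto. Every direction
    -- `aY` is thus the image of some `(0, c)`, whose `W`-component is zero.
    have hy : Function.Injective y := by
      intro c c' h
      have h1 : fderiv ℝ Φ (Ψ a) (0, c) = fderiv ℝ Φ (Ψ a) (0, c') := by rw [hFy, hFy, h]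
      have h2 := congrArg (fderiv ℝ Ψ a) h1
      have h3 (q) : fderiv ℝ Ψ a (fderiv ℝ Φ (Ψ a) q) = q := congrArg (fun A => A q) hDF
      rw [h3, h3] at h2
      exact congrArg Prod.snd h2
    obtain ⟨c, hc⟩ := LinearMap.injective_iff_surjective.mp hy ⟨Y, hY⟩
    have h1 := hFy c
    rw [hc] at h1
    have h3 : fderiv ℝ Ψ a (fderiv ℝ Φ (Ψ a) (0, c)) = (0, c) := congrArg (fun A => A (0, c)) hDF
    rw [ContinuousLinearMap.comp_apply, ← h1, h3]
    simp [pr]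
  · have h1 : HasFDerivAt Ψ (e.symm : 𝔸 →L[ℝ] W × V) 1 := by
      have := (hstr.to_localInverse).hasFDerivAt
      rwa [hΦ1] at this
    refine ⟨pr ∘L (e.symm : 𝔸 →L[ℝ] W × V), pr.hasFDerivAt.comp 1 h1, fun X hX => ?_⟩
    have h2 : (e.symm X).1 = 0 := Subtype.ext hX
    have h3 : X = e (e.symm X) := (e.apply_symm_apply X).symm
    have h4 : e (e.symm X) = (e.symm X).1 + (e.symm X).2 := rfl
    rw [h3, h4, h2]
    simp

end Leaf

/-! ### Countable subgroups and tangent paths in groups generated by one-parameter groups. -/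

section Leaf

theorem Subgroup.countable_closure {A : Type*} [Group A] {s : Set A} (hs : s.Countable) :
    (Subgroup.closure s : Set A).Countable := by
  have : Countable s := hs.to_subtype
  have h : (FreeGroup.lift (fun x : s => (x : A))).range = Subgroup.closure s := by
    rw [FreeGroup.range_lift_eq_closure, Subtype.range_coe]
  rw [← h]
  have : Countable (FreeGroup s) := by
    unfold FreeGroup; infer_instance
  exact Set.countable_range _

variable {𝔸 : Type*} [NormedRing 𝔸] [NormedAlgebra ℝ 𝔸] [CompleteSpace 𝔸]

/-- The group generated by the one-parameter groups of a set of generators. -/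
noncomputable def expGroup (B : Set 𝔸) : Subgroup 𝔸ˣ :=
  Subgroup.closure {u | ∃ X ∈ B, ∃ t : ℝ, u = oneParam X t}

/-- The countable group generated by the rational points of one-parameter groups. -/
noncomputable def rationalExpGroup (B : Set 𝔸) : Subgroup 𝔸ˣ :=
  Subgroup.closure {u | ∃ X ∈ B, ∃ t : ℚ, u = oneParam X t}

theorem oneParam_mem_expGroup {B : Set 𝔸} {X : 𝔸} (hX : X ∈ B) (t : ℝ) :
    oneParam X t ∈ expGroup B :=
  Subgroup.subset_closure ⟨X, hX, t, rfl⟩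

theorem countable_rationalExpGroup {B : Set 𝔸} (hB : B.Countable) :
    (rationalExpGroup B : Set 𝔸ˣ).Countable := by
  refine Subgroup.countable_closure ?_
  have : {u : 𝔸ˣ | ∃ X ∈ B, ∃ t : ℚ, u = oneParam X t}
      = ⋃ X ∈ B, Set.range fun t : ℚ => oneParam X t := by
    ext u; simp [eq_comm]
  rw [this]
  exact hB.biUnion fun X _ => Set.countable_range _

variable [FiniteDimensional ℝ 𝔸]

/-- Both directions of conjugation are carried together so that the induction passes through
inverses. -/
theorem conj_expGroup_mem {V : Submodule ℝ 𝔸} (hV : ∀ X ∈ V, ∀ Y ∈ V, ⁅X, Y⁆ ∈ V) {B : Set 𝔸}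
    (hB : B ⊆ V) {u : 𝔸ˣ} (hu : u ∈ expGroup B) :
    ∀ Y ∈ V, (u : 𝔸) * Y * ((u⁻¹ : 𝔸ˣ) : 𝔸) ∈ V ∧ ((u⁻¹ : 𝔸ˣ) : 𝔸) * Y * u ∈ V := by
  induction hu using Subgroup.closure_induction with
  | mem u hu =>
    obtain ⟨X, hX, t, rfl⟩ := hu
    intro Y hY
    have h1 := conj_oneParam_mem (hV X (hB hX)) hY t
    have h2 := conj_oneParam_mem (hV X (hB hX)) hY (-t)
    rw [oneParam_neg, inv_inv] at h2
    exact ⟨h1, h2⟩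
  | one => intro Y hY; simpa using hY
  | mul u v _ _ hu hv =>
    intro Y hY
    have h1 := (hu _ (hv Y hY).1).1
    have h2 := (hv _ (hu Y hY).2).2
    constructor
    · simpa [mul_assoc] using h1
    · simpa [mul_assoc] using h2
  | inv u _ hu =>
    intro Y hY
    rw [inv_inv]
    exact (hu Y hY).symm

/-- Every element of `expGroup B` is joined to an element of the countable group
`rationalExpGroup B` by an arbitrarily small curve which is tangent to the left translates
of `V`. -/
theorem exists_tangent_path {V : Submodule ℝ 𝔸} (hV : ∀ X ∈ V, ∀ Y ∈ V, ⁅X, Y⁆ ∈ V) {B : Set 𝔸}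
    (hB : B ⊆ V) {u : 𝔸ˣ} (hu : u ∈ expGroup B) :
    ∀ N ∈ 𝓝 u, ∃ a : ℝ → 𝔸ˣ, a 0 ∈ rationalExpGroup B ∧ a 1 = u ∧
      (∀ s ∈ Set.Icc (0 : ℝ) 1, a s ∈ N) ∧
      ∀ s, a s ∈ expGroup B ∧ ∃ Y ∈ V, HasDerivAt (fun s => (a s : 𝔸)) (a s * Y) s := by
  induction hu using Subgroup.closure_induction with
  | mem u hu =>
    obtain ⟨X, hX, t, rfl⟩ := hu
    intro N hN
    obtain ⟨ε, hε, hball⟩ := Metric.eventually_nhds_iff_ball.mp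
      ((continuous_oneParam X).continuousAt.eventually hN)
    -- The path follows the one-parameter group from a nearby rational parameter `q` to `t`.
    obtain ⟨q, hq1, hq2⟩ := exists_rat_btwn (show t - ε < t by linarith)
    refine ⟨fun s => oneParam X (q + s * (t - q)), ?_, by simp, fun s hs => hball _ ?_,
      fun s => ⟨oneParam_mem_expGroup hX _, (t - q) • X, V.smul_mem _ (hB hX), ?_⟩⟩
    · exact Subgroup.subset_closure ⟨X, hX, q, by simp⟩
    · rw [Metric.mem_ball, Real.dist_eq, abs_lt]
      obtain ⟨h0, h1⟩ := hs
      constructor <;> nlinarith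
    · have h1 : HasDerivAt (fun s : ℝ => (q : ℝ) + s * (t - q)) (t - q) s := by
        simpa using ((hasDerivAt_id s).mul_const (t - (q : ℝ))).const_add (q : ℝ)
      simpa using! (hasDerivAt_oneParam X (q + s * (t - q))).scomp s h1
  | one =>
    intro N hN
    exact ⟨fun _ => 1, one_mem _, rfl, fun _ _ => mem_of_mem_nhds hN,
      fun s => ⟨one_mem _, 0, zero_mem _, by simpa using hasDerivAt_const s (1 : 𝔸)⟩⟩
  | mul u v _ _ hu hv =>
    intro N hN
    have h1 : Filter.Tendsto (fun p : 𝔸ˣ × 𝔸ˣ => p.1 * p.2) (𝓝 u ×ˢ 𝓝 v) (𝓝 (u * v)) := by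
      rw [← nhds_prod_eq]; exact continuous_mul.tendsto (u, v)
    obtain ⟨N₁, hN₁, N₂, hN₂, hN12⟩ := Filter.mem_prod_iff.mp (h1 hN)
    obtain ⟨a, a0, a1, aN, ha⟩ := hu N₁ hN₁
    obtain ⟨b, b0, b1, bN, hb⟩ := hv N₂ hN₂
    refine ⟨fun s => a s * b s, mul_mem a0 b0, by simp [a1, b1],
      fun s hs => hN12 (Set.mk_mem_prod (aN s hs) (bN s hs)), fun s => ?_⟩
    obtain ⟨has, Y, hY, hYd⟩ := ha s
    obtain ⟨hbs, Z, hZ, hZd⟩ := hb s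
    -- If `a' = aY` and `b' = bZ`, then `(ab)' = ab(b⁻¹Yb + Z)`.
    refine ⟨mul_mem has hbs, _, add_mem (conj_expGroup_mem hV hB hbs Y hY).2 hZ, ?_⟩
    simpa [mul_add, mul_assoc] using hYd.fun_mul hZd
  | inv u _ hu =>
    intro N hN
    have h1 : Filter.Tendsto (fun p : 𝔸ˣ => p⁻¹) (𝓝 u) (𝓝 u⁻¹) := continuous_inv.tendsto u
    obtain ⟨a, a0, a1, aN, ha⟩ := hu _ (h1 hN)
    refine ⟨fun s => (a s)⁻¹, inv_mem a0, by simp [a1], fun s hs => aN s hs, fun s => ?_⟩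
    obtain ⟨has, Y, hY, hYd⟩ := ha s
    -- If `a' = aY`, then `(a⁻¹)' = -a⁻¹(aYa⁻¹)`.
    refine ⟨inv_mem has, _, neg_mem (conj_expGroup_mem hV hB has Y hY).1, ?_⟩
    have h2 := (hasFDerivAt_ringInverse (𝕜 := ℝ) (a s)).comp_hasDerivAt s hYd
    simpa [Function.comp_def, mul_assoc] using! h2

/-- If `V` is a Lie subalgebra of a finite-dimensional algebra which contains the countable set
`B`, then `V` contains the velocities at the identity of all `C^1` curves in the group generated
by the one-parameter groups of the elements of `B`. -/
theorem velocitySet_expGroup_subset {V : Submodule ℝ 𝔸} (hV : ∀ X ∈ V, ∀ Y ∈ V, ⁅X, Y⁆ ∈ V)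
    {B : Set 𝔸} (hB : B ⊆ V) (hBc : B.Countable) : velocitySet (expGroup B) ⊆ V := by
  rintro X ⟨γ, h0, hγ, hc, hd⟩
  obtain ⟨w, hw, D, hD, hDV⟩ := exists_firstIntegral hV
  obtain ⟨Ω, hΩ, hΩo, h1Ω⟩ := eventually_nhds_iff.mp hw
  have hcont : ∀ᶠ t in 𝓝 (0 : ℝ), ContinuousAt γ t :=
    (hc.eventually (by simp)).mono fun t ht => ht.continuousAt
  have hin : ∀ᶠ t in 𝓝 (0 : ℝ), γ t ∈ Ω :=
    hc.continuousAt.eventually (by rw [h0]; exact hΩo.mem_nhds h1Ω)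
  obtain ⟨ε, hε, hball⟩ := Metric.eventually_nhds_iff_ball.mp (hγ.and (hcont.and hin))
  -- Along the tangent path ending at `γ(t)` the function `w` is constant, so `w (γ t)` is already
  -- attained on the countable group.
  have hcount : ((fun t => w (γ t)) '' Metric.ball 0 ε).Countable := by
    refine ((countable_rationalExpGroup hBc).image fun u : 𝔸ˣ => w u).mono ?_
    rintro _ ⟨t, ht, rfl⟩
    obtain ⟨⟨u, hu, e⟩, -, htΩ⟩ := hball t ht
    have hN : {v : 𝔸ˣ | (v : 𝔸) ∈ Ω} ∈ 𝓝 u :=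
      (hΩo.preimage Units.continuous_val).mem_nhds (by simpa [e] using htΩ)
    obtain ⟨a, a0, a1, aN, ha⟩ := exists_tangent_path hV hB hu _ hN
    have hda (s : ℝ) (hs : s ∈ Set.Icc (0 : ℝ) 1) :
        HasDerivAt (fun s => w (a s)) 0 s := by
      obtain ⟨D', hD', hDV'⟩ := hΩ _ (aN s hs)
      obtain ⟨-, Y, hY, hYd⟩ := ha s
      have := hD'.comp_hasDerivAt s hYd
      rwa [hDV' Y hY] at this
    have := constant_of_has_deriv_right_zero (f := fun s => w (a s))
      (fun s hs => (hda s hs).continuousAt.continuousWithinAt)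
      (fun s hs => (hda s (Set.Ico_subset_Icc_self hs)).hasDerivWithinAt) 1
      (Set.right_mem_Icc.mpr zero_le_one)
    exact ⟨a 0, a0, by simp only [a1, e] at this; exact this.symm⟩
  have hconn : IsPreconnected ((fun t => w (γ t)) '' Metric.ball 0 ε) := by
    refine (convex_ball (0 : ℝ) ε).isPreconnected.image _ fun t ht => ?_
    obtain ⟨-, htc, htΩ⟩ := hball t ht
    obtain ⟨D', hD', -⟩ := hΩ _ htΩ
    exact (ContinuousAt.comp (g := w) hD'.continuousAt htc).continuousWithinAt
  -- A countable connected subset of a metric space has at most one point.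
  have hsub := hcount.isTotallyDisconnected _ subset_rfl hconn
  have hconst : (fun t => w (γ t)) =ᶠ[𝓝 0] fun _ => w (γ 0) := by
    filter_upwards [Metric.ball_mem_nhds (0 : ℝ) hε] with t ht
    exact hsub ⟨t, ht, rfl⟩ ⟨0, Metric.mem_ball_self hε, rfl⟩
  have hder : HasDerivAt (fun t => w (γ t)) (D X) 0 :=
    HasFDerivAt.comp_hasDerivAt 0 (by rwa [h0]) hd
  exact hDV X (hder.unique ((hasDerivAt_const (0 : ℝ) (w (γ 0))).congr_of_eventuallyEq hconst))

end Leaf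

/-! ### Birepresentations of Moufang loops in groups -/

namespace MoufangLoop

section Loop

variable {G : Type*} [MoufangLoop G]

/-- The Moufang identity with `h = a⁻¹` gives `ag = (a(ga⁻¹))a`; with its middle entry `1` it gives
`a(ka) = (ak)a`. For `k = ga⁻¹` the factor `a` cancels on the left. -/
theorem mul_inv_mul_right (a g : G) : (g * a⁻¹) * a = g := by
  have h1 := moufang a g a⁻¹
  rw [inv_mul', mul_one'] at h1
  have h2 := moufang a 1 (g * a⁻¹)
  rw [mul_one', one_mul', ← h1] at h2
  exact (existsUnique_mul_left a (a * g)).unique h2 rfl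

theorem mul_mul_inv_right (a g : G) : (g * a) * a⁻¹ = g := by
  have h := mul_inv_mul_right a⁻¹ g
  rwa [inv_inv'] at h

theorem mul_inv_rev' (g h : G) : (g * h)⁻¹ = h⁻¹ * g⁻¹ := by
  have h1 : (g * h)⁻¹ * g = h⁻¹ := by
    have := inv_mul_mul (g * h) h⁻¹
    rwa [mul_mul_inv_right] at this
  rw [← h1, mul_mul_inv_right]

/-- A subset of a Moufang loop which contains the unit and is closed under products and
inverses. -/
structure IsSubloop (M : Set G) : Prop where
  one_mem : 1 ∈ M
  mul_mem : ∀ {g h : G}, g ∈ M → h ∈ M → g * h ∈ M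
  inv_mem : ∀ {g : G}, g ∈ M → g⁻¹ ∈ M

end Loop

end MoufangLoop

open MoufangLoop

/-- A birepresentation of a Moufang loop in an arbitrary group. -/
structure IsGroupBirepresentation {G U : Type*} [MoufangLoop G] [Group U] (S T : G → U) :
    Prop where
  left_one : S 1 = 1
  right_one : T 1 = 1
  left_mul : ∀ g h : G, T g * S g * S h = S (g * h) * T g
  right_mul : ∀ g h : G, S g * T g * T h = T (h * g) * S g

namespace IsGroupBirepresentation

variable {G U : Type*} [MoufangLoop G] [Group U] {S T : G → U} (hST : IsGroupBirepresentation S T)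
include hST

theorem comm (g : G) : T g * S g = S g * T g := by
  have := hST.left_mul g 1
  rwa [hST.left_one, mul_one, mul_one'] at this

theorem left_inv (g : G) : S g⁻¹ = (S g)⁻¹ := by
  have := hST.left_mul g g⁻¹
  rw [MoufangLoop.mul_inv', hST.left_one, one_mul, mul_assoc, mul_eq_left] at this
  exact eq_inv_of_mul_eq_one_right this

theorem right_inv (g : G) : T g⁻¹ = (T g)⁻¹ := by
  have := hST.right_mul g g⁻¹
  rw [MoufangLoop.inv_mul', hST.right_one, one_mul, mul_assoc, mul_eq_left] at this
  exact eq_inv_of_mul_eq_one_right this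

theorem map_mul_left (g h : G) : S (g * h) = S g * T g * S h * (T g)⁻¹ := by
  rw [← hST.comm, hST.left_mul, mul_inv_cancel_right]

theorem map_mul_right (g h : G) : T (g * h) = S h * T h * T g * (S h)⁻¹ := by
  rw [hST.right_mul, mul_inv_cancel_right]

/-- Obtained from `map_mul_right` by inverting both factors. Here `h` occurs only once, which makes
the formula suitable for differentiation in `h`. -/
theorem map_mul_right' (g h : G) : T (g * h) = (S g)⁻¹ * T h * T g * S g := by
  have h1 := hST.map_mul_right h⁻¹ g⁻¹
  rw [← mul_inv_rev', hST.right_inv, hST.left_inv, hST.right_inv, hST.right_inv] at h1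
  rw [← inv_inv (T (g * h)), h1]
  simp only [mul_inv_rev, inv_inv]
  simp only [mul_assoc, hST.comm]

/-- The elements of a Moufang loop which are mapped to a given subgroup by both parts of a
birepresentation form a subloop. -/
theorem isSubloop_preimage (K : Subgroup U) : IsSubloop {g : G | S g ∈ K ∧ T g ∈ K} where
  one_mem := by simp only [Set.mem_ofPred_eq, hST.left_one, hST.right_one, one_mem, and_self]
  mul_mem := by
    rintro g h ⟨h1, h2⟩ ⟨h3, h4⟩
    refine ⟨?_, ?_⟩
    · rw [hST.map_mul_left]
      exact mul_mem (mul_mem (mul_mem h1 h2) h3) (inv_mem h2)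
    · rw [hST.map_mul_right]
      exact mul_mem (mul_mem (mul_mem h3 h4) h2) (inv_mem h3)
  inv_mem := by
    rintro g ⟨h1, h2⟩
    refine ⟨?_, ?_⟩
    · rw [hST.left_inv]; exact inv_mem h1
    · rw [hST.right_inv]; exact inv_mem h2

end IsGroupBirepresentation

namespace MoufangLoop

section Analytic

variable (r : ℕ) {G : Type*} [TopologicalSpace G] [ChartedSpace (EuclideanSpace ℝ (Fin r)) G]
  [MoufangLoop G] [AnalyticMoufangLoop r G]

include r in
/-- In a connected analytic Moufang loop, a subloop which is a neighbourhood of the unit is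
the whole loop. -/
theorem IsSubloop.eq_univ [ConnectedSpace G] {M : Set G} (hM : IsSubloop M)
    (h1 : M ∈ 𝓝 (1 : G)) : M = Set.univ := by
  have hcont (g : G) : Continuous fun h : G => g * h := (contMDiff_mul_left r g).continuous
  have hnhds (g : G) : ∀ᶠ k in 𝓝 g, g⁻¹ * k ∈ M := by
    have h2 := (hcont g⁻¹).continuousAt (x := g)
    rw [ContinuousAt, inv_mul'] at h2
    exact h2 h1
  refine IsClopen.eq_univ ⟨?_, ?_⟩ ⟨1, hM.one_mem⟩
  · rw [← isOpen_compl_iff, isOpen_iff_mem_nhds]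
    intro g hg
    filter_upwards [hnhds g] with k hk hkM
    refine hg ?_
    -- If such a `k` near `g` were in `M`, then `g` would be too; hence the complement of `M` is
    -- open.
    have e : k * (g⁻¹ * k)⁻¹ = g := by
      have h2 := mul_mul_inv_right (g⁻¹ * k) g
      rwa [mul_inv_mul] at h2
    rw [← e]
    exact hM.mul_mem hkM (hM.inv_mem hk)
  · rw [isOpen_iff_mem_nhds]
    intro g hg
    filter_upwards [hnhds g] with k hk
    rw [← mul_inv_mul g k]
    exact hM.mul_mem hg hk

end Analytic

end MoufangLoop

/-! ### Lie brackets of vector fields as commutators of derivations -/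

section LieBracket

open VectorField

variable {E : Type*} [NormedAddCommGroup E] [NormedSpace ℝ E]
  {F : Type*} [NormedAddCommGroup F] [NormedSpace ℝ F]

theorem DifferentiableAt.of_clm_apply [FiniteDimensional ℝ E]
    {D : Type*} [NormedAddCommGroup D] [NormedSpace ℝ D] {f : D → E →L[ℝ] F} {p : D}
    (h : ∀ x, DifferentiableAt ℝ (fun q => f q x) p) : DifferentiableAt ℝ f p := by
  let b := Module.finBasis ℝ E
  have e : f = fun q => ∑ i, ContinuousLinearMap.smulRightL ℝ E F
      (LinearMap.toContinuousLinearMap (b.coord i)) (f q (b i)) := by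
    funext q
    ext x
    conv_lhs => rw [← b.sum_repr x]
    simp [-Module.Basis.sum_repr]
  rw [e]
  exact DifferentiableAt.fun_sum fun i _ =>
    (ContinuousLinearMap.differentiableAt _).comp p (h (b i))

/-- After the product rule the second-derivative terms cancel by symmetry. For that it is enough
that `f` is differentiable near `p` and its derivative is differentiable at `p`. -/
theorem fderiv_lieBracket_apply {f : E → F} {V W : E → E} {p : E}
    (hf : ∀ᶠ q in 𝓝 p, DifferentiableAt ℝ f q) (hf' : DifferentiableAt ℝ (fderiv ℝ f) p)
    (hV : DifferentiableAt ℝ V p) (hW : DifferentiableAt ℝ W p) :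
    fderiv ℝ f p (lieBracket ℝ V W p) =
      fderiv ℝ (fun q => fderiv ℝ f q (W q)) p (V p)
        - fderiv ℝ (fun q => fderiv ℝ f q (V q)) p (W p) := by
  have hs := second_derivative_symmetric_of_eventually
    (hf.mono fun q hq => hq.hasFDerivAt) hf'.hasFDerivAt (V p) (W p)
  rw [fderiv_clm_apply hf' hW, fderiv_clm_apply hf' hV, lieBracket_eq]
  simp [hs]

/-- A function is twice differentiable if its derivatives along a differentiable frame are
differentiable. -/
theorem differentiableAt_fderiv_of_frame [FiniteDimensional ℝ E] {f : E → F}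
    {A : E → E →L[ℝ] E} {p : E} (hA : ∀ᶠ q in 𝓝 p, (A q).IsInvertible)
    (hAd : ∀ x, DifferentiableAt ℝ (fun q => A q x) p)
    (hfA : ∀ x, DifferentiableAt ℝ (fun q => fderiv ℝ f q (A q x)) p) :
    DifferentiableAt ℝ (fderiv ℝ f) p := by
  have : CompleteSpace E := FiniteDimensional.complete ℝ E
  have h1 : DifferentiableAt ℝ (fun q => (fderiv ℝ f q) ∘L (A q)) p :=
    DifferentiableAt.of_clm_apply hfA
  have h2 : DifferentiableAt ℝ (fun q => (A q).inverse) p :=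
    ((hA.self_of_nhds.contDiffAt_map_inverse (𝕜 := ℝ) (n := 1)).differentiableAt
      one_ne_zero).comp p (DifferentiableAt.of_clm_apply hAd)
  -- Near `p` the derivative equals `(df ∘ A) ∘ A⁻¹`, a composition of differentiable factors.
  refine (h1.clm_comp h2).congr_of_eventuallyEq ?_
  filter_upwards [hA] with q hq
  ext x
  simp [hq.self_apply_inverse]

variable {M : Type*} [TopologicalSpace M] [ChartedSpace E M]

/-- The derivative of a vector-valued function along a tangent vector. -/
noncomputable def tangentDeriv (f : M → F) (g : M) (v : TangentSpace 𝓘(ℝ, E) g) : F :=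
  mfderiv 𝓘(ℝ, E) 𝓘(ℝ, F) f g v

theorem differentiableAt_comp_extChartAt_symm [IsManifold 𝓘(ℝ, E) 1 M] {f : M → F} {g : M} {q : E}
    (hq : q ∈ (extChartAt 𝓘(ℝ, E) g).target)
    (hf : MDifferentiableAt 𝓘(ℝ, E) 𝓘(ℝ, F) f ((extChartAt 𝓘(ℝ, E) g).symm q)) :
    DifferentiableAt ℝ (f ∘ (extChartAt 𝓘(ℝ, E) g).symm) q ∧
    ∀ v, fderiv ℝ (f ∘ (extChartAt 𝓘(ℝ, E) g).symm) q v =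
      mfderiv 𝓘(ℝ, E) 𝓘(ℝ, F) f ((extChartAt 𝓘(ℝ, E) g).symm q)
        (mfderivWithin 𝓘(ℝ, E) 𝓘(ℝ, E) (extChartAt 𝓘(ℝ, E) g).symm
          (Set.range 𝓘(ℝ, E)) q v) := by
  have h1 := mdifferentiableWithinAt_extChartAt_symm (I := 𝓘(ℝ, E)) hq
  rw [𝓘(ℝ, E).range_eq_univ, mdifferentiableWithinAt_univ] at h1
  refine ⟨(hf.comp q h1).differentiableAt, fun v => ?_⟩
  rw [← mfderiv_eq_fderiv, mfderiv_comp q hf h1, 𝓘(ℝ, E).range_eq_univ, mfderivWithin_univ]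
  rfl

/-- The Lie bracket of two members of a frame of vector fields acts on functions as the
commutator of derivations. -/
theorem tangentDeriv_mlieBracket [FiniteDimensional ℝ E] [IsManifold 𝓘(ℝ, E) 2 M]
    [IsManifold 𝓘(ℝ, E) 1 M] {f : M → F} {g : M}
    (A : ∀ h : M, E →L[ℝ] TangentSpace 𝓘(ℝ, E) h)
    (hA : ∀ h, (A h).IsInvertible)
    (hAd : ∀ x, MDifferentiableAt 𝓘(ℝ, E) 𝓘(ℝ, E).tangent
      (fun h => (⟨h, A h x⟩ : TangentBundle 𝓘(ℝ, E) M)) g)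
    (hf : MDifferentiable 𝓘(ℝ, E) 𝓘(ℝ, F) f)
    {Φ : E → M → F} (hΦ : ∀ x h, tangentDeriv f h (A h x) = Φ x h)
    (hΦd : ∀ x, MDifferentiable 𝓘(ℝ, E) 𝓘(ℝ, F) (Φ x)) (x y : E) :
    tangentDeriv f g (mlieBracket 𝓘(ℝ, E) (fun h => A h x) (fun h => A h y) g) =
      tangentDeriv (Φ y) g (A g x) - tangentDeriv (Φ x) g (A g y) := by
  have : CompleteSpace E := FiniteDimensional.complete ℝ E
  let φ := extChartAt 𝓘(ℝ, E) g
  let p := φ g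
  have hp : p ∈ φ.target := mem_extChartAt_target g
  have hpt : ∀ᶠ q in 𝓝 p, q ∈ φ.target := extChartAt_target_mem_nhds g
  have hφp : φ.symm p = g := extChartAt_to_inv g
  let J (q : E) : E →L[ℝ] TangentSpace 𝓘(ℝ, E) (φ.symm q) :=
    mfderivWithin 𝓘(ℝ, E) 𝓘(ℝ, E) φ.symm (Set.range 𝓘(ℝ, E)) q
  have hJ : ∀ q ∈ φ.target, (J q).IsInvertible := fun q hq =>
    isInvertible_mfderivWithin_extChartAt_symm hq
  -- The frame `A` read in the chart at `g`.
  let B (q : E) : E →L[ℝ] E := (J q).inverse ∘L A (φ.symm q)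
  have hBV (x : E) : mpullbackWithin 𝓘(ℝ, E) 𝓘(ℝ, E) φ.symm (fun h => A h x)
      (Set.range 𝓘(ℝ, E)) = fun q => B q x := rfl
  have hB : ∀ᶠ q in 𝓝 p, (B q).IsInvertible := hpt.mono fun q hq =>
    (hJ q hq).inverse.comp (hA _)
  have hBd (x : E) : DifferentiableAt ℝ (fun q => B q x) p := by
    have := MDifferentiableWithinAt.differentiableWithinAt_mpullbackWithin_vectorField
      (s := Set.univ) ((hAd x).mdifferentiableWithinAt)
    rw [hBV, Set.preimage_univ, 𝓘(ℝ, E).range_eq_univ, Set.univ_inter,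
      differentiableWithinAt_univ] at this
    exact this
  have hpush {f : M → F} (hf : MDifferentiable 𝓘(ℝ, E) 𝓘(ℝ, F) f) (x : E) (q : E)
      (hq : q ∈ φ.target) : fderiv ℝ (f ∘ φ.symm) q (B q x) =
        tangentDeriv f (φ.symm q) (A (φ.symm q) x) := by
    rw [(differentiableAt_comp_extChartAt_symm hq (hf _)).2]
    exact congrArg _ ((hJ q hq).self_apply_inverse _)
  have hfB (x : E) : (fun q => fderiv ℝ (f ∘ φ.symm) q (B q x)) =ᶠ[𝓝 p] Φ x ∘ φ.symm :=
    hpt.mono fun q hq => (hpush hf x q hq).trans (hΦ x _)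
  have hΦp (x : E) : DifferentiableAt ℝ (Φ x ∘ φ.symm) p :=
    (differentiableAt_comp_extChartAt_symm hp (hΦd x _)).1
  -- Regularity is gained here: `f` is only assumed differentiable, but its derivatives along the
  -- frame are the differentiable functions `Φ x`.
  have hf2 : DifferentiableAt ℝ (fderiv ℝ (f ∘ φ.symm)) p :=
    differentiableAt_fderiv_of_frame hB hBd
      fun x => (hΦp x).congr_of_eventuallyEq (hfB x)
  have key := fderiv_lieBracket_apply
    (hpt.mono fun q hq => (differentiableAt_comp_extChartAt_symm hq (hf _)).1) hf2 (hBd x) (hBd y)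
  rw [(hfB x).fderiv_eq, (hfB y).fderiv_eq, hpush (hΦd y) x p hp, hpush (hΦd x) y p hp, hφp] at key
  rw [← key]
  let u : E := lieBracket ℝ (fun q => B q x) (fun q => B q y) p
  have hbr : mlieBracket 𝓘(ℝ, E) (fun h => A h x) (fun h => A h y) g
      = (mfderiv 𝓘(ℝ, E) 𝓘(ℝ, E) φ g).inverse u := by
    rw [← mlieBracketWithin_univ, mlieBracketWithin_apply, Set.preimage_univ,
      Set.univ_inter, hBV, hBV, 𝓘(ℝ, E).range_eq_univ, lieBracketWithin_univ]
  rw [hbr]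
  have hinv : (mfderiv 𝓘(ℝ, E) 𝓘(ℝ, E) φ g).IsInvertible :=
    isInvertible_mfderiv_extChartAt (mem_extChartAt_source g)
  have hcomp : (f ∘ φ.symm) ∘ φ =ᶠ[𝓝 g] f := by
    filter_upwards [extChartAt_source_mem_nhds (I := 𝓘(ℝ, E)) g] with h hh
    exact congrArg f (φ.left_inv hh)
  have h1 := mfderiv_comp_apply (I := 𝓘(ℝ, E)) (I' := 𝓘(ℝ, E)) (I'' := 𝓘(ℝ, F)) g
    (g := f ∘ φ.symm) (f := φ)
    (differentiableAt_comp_extChartAt_symm hp (hf _)).1.mdifferentiableAt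
    (mdifferentiableAt_extChartAt (mem_chart_source E g))
    ((mfderiv 𝓘(ℝ, E) 𝓘(ℝ, E) φ g).inverse u)
  have h2 (v : TangentSpace 𝓘(ℝ, E) g) :
      tangentDeriv f g v = tangentDeriv ((f ∘ φ.symm) ∘ φ) g v :=
    (congrArg (fun D : E →L[ℝ] F => D v) hcomp.mfderiv_eq).symm
  refine (h2 _).trans (h1.trans ?_)
  have h3 := hinv.self_apply_inverse u
  exact (congrArg (mfderiv 𝓘(ℝ, E) 𝓘(ℝ, F) (f ∘ φ.symm) (φ g)) h3).trans
    (congrArg (fun D : E →L[ℝ] F => D u) mfderiv_eq_fderiv)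

end LieBracket

/-! ### The fields `v_x`: regularity and integral curves. -/

namespace MoufangLoop

section AuxField

open VectorField Bundle

variable (r : ℕ) {G : Type*} [TopologicalSpace G] [ChartedSpace (EuclideanSpace ℝ (Fin r)) G]
  [MoufangLoop G]

theorem aux_one : aux r (1 : G) = ContinuousLinearMap.id ℝ (TangentSpace (𝓡 r) (1 : G)) := by
  have h : (fun h : G => 1 * h) = id := by funext h; exact one_mul' h
  unfold aux
  rw [h]
  exact mfderiv_id

variable [AnalyticMoufangLoop r G]

/-- The vector `v_x(g)` is the image of `(0_g, x)` under the tangent map of the multiplication. -/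
theorem contMDiff_aux (x : TangentSpace (𝓡 r) (1 : G)) :
    ContMDiff (𝓡 r) (𝓡 r).tangent 1
      (fun g : G => (⟨g, aux r g x⟩ : TangentBundle (𝓡 r) G)) := by
  let E := EuclideanSpace ℝ (Fin r)
  let fg : G → TangentBundle (𝓡 r) G := fun g ↦ TotalSpace.mk' E g 0
  have sfg : ContMDiff (𝓡 r) (𝓡 r).tangent 1 fg := contMDiff_zeroSection _ _
  let fv : G → TangentBundle (𝓡 r) G := fun _ ↦ TotalSpace.mk' E 1 x
  have sfv : ContMDiff (𝓡 r) (𝓡 r).tangent 1 fv := contMDiff_const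
  let F₁ : G → (TangentBundle (𝓡 r) G × TangentBundle (𝓡 r) G) := fun g ↦ (fg g, fv g)
  have S₁ : ContMDiff (𝓡 r) _ 1 F₁ := sfg.prodMk sfv
  let F₂ : (TangentBundle (𝓡 r) G × TangentBundle (𝓡 r) G) →
      TangentBundle ((𝓡 r).prod (𝓡 r)) (G × G) :=
    (equivTangentBundleProd (𝓡 r) G (𝓡 r) G).symm
  have S₂ : ContMDiff _ _ 1 F₂ := contMDiff_equivTangentBundleProd_symm
  let F₃ : TangentBundle ((𝓡 r).prod (𝓡 r)) (G × G) → TangentBundle (𝓡 r) G :=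
    tangentMap ((𝓡 r).prod (𝓡 r)) (𝓡 r) (fun (p : G × G) ↦ p.1 * p.2)
  have hmul := AnalyticMoufangLoop.contMDiff_mul (r := r) (G := G)
  have S₃ : ContMDiff ((𝓡 r).prod (𝓡 r)).tangent (𝓡 r).tangent 1 F₃ :=
    ContMDiff.contMDiff_tangentMap hmul (m := 1) le_top
  let S := (S₃.comp S₂).comp S₁
  convert! S with g
  · exact (mul_one' g).symm
  · simp only [Function.comp_apply, tangentMap, F₃, F₂, F₁, fg, fv]
    rw [mfderiv_prod_eq_add_apply (hmul.mdifferentiableAt (by simp))]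
    let A : E →L[ℝ] E := mfderiv (𝓡 r) (𝓡 r) (fun h : G => h * 1) g
    let B : E →L[ℝ] E := mfderiv (𝓡 r) (𝓡 r) (fun h : G => g * h) 1
    let x' : E := x
    have h : B x' = A 0 + B x' := by rw [map_zero, zero_add]
    exact h

theorem mdifferentiableAt_aux (x : TangentSpace (𝓡 r) (1 : G)) (g : G) :
    MDifferentiableAt (𝓡 r) (𝓡 r).tangent
      (fun g : G => (⟨g, aux r g x⟩ : TangentBundle (𝓡 r) G)) g :=
  (contMDiff_aux r x).mdifferentiableAt one_ne_zero

theorem bracket_neg_right (g : G) (x y : TangentSpace (𝓡 r) (1 : G)) :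
    bracket r g x (-y) = -bracket r g x y := by
  have h := mlieBracket_const_smul_right (V := fun k : G => aux r k x) (c := (-1 : ℝ))
    (mdifferentiableAt_aux r y g)
  have e : (fun k : G => aux r k (-y)) = (-1 : ℝ) • fun k : G => aux r k y := by
    funext k; simp
  unfold bracket
  rw [e, h, neg_one_smul, map_neg]

theorem bracket_neg_left (g : G) (x y : TangentSpace (𝓡 r) (1 : G)) :
    bracket r g (-x) y = -bracket r g x y := by
  have h := mlieBracket_const_smul_left (W := fun k : G => aux r k y) (c := (-1 : ℝ))
    (mdifferentiableAt_aux r x g)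
  have e : (fun k : G => aux r k (-x)) = (-1 : ℝ) • fun k : G => aux r k x := by
    funext k; simp
  unfold bracket
  rw [e, h, neg_one_smul, map_neg]

variable {F : Type*} [NormedAddCommGroup F] [NormedSpace ℝ F]

omit [MoufangLoop G] [AnalyticMoufangLoop r G] in
theorem hasDerivAt_comp_curve {f : G → F} {c : ℝ → G} {t : ℝ}
    {v : TangentSpace (𝓡 r) (c t)} (hf : MDifferentiableAt (𝓡 r) 𝓘(ℝ, F) f (c t))
    (hc : HasMFDerivAt 𝓘(ℝ, ℝ) (𝓡 r) c t ((1 : ℝ →L[ℝ] ℝ).smulRight v)) :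
    HasDerivAt (fun s => f (c s)) (tangentDeriv f (c t) v) t := by
  let D : EuclideanSpace ℝ (Fin r) →L[ℝ] F := mfderiv (𝓡 r) 𝓘(ℝ, F) f (c t)
  let v' : EuclideanSpace ℝ (Fin r) := v
  have h1 : HasFDerivAt (fun s => f (c s)) (D ∘L (1 : ℝ →L[ℝ] ℝ).smulRight v') t :=
    (hf.hasMFDerivAt.comp t hc).hasFDerivAt
  have h2 := h1.hasDerivAt
  simpa using! h2

/-- Local integral curves of the fields `aux r · x`. -/
theorem exists_integralCurve (g : G) (x : TangentSpace (𝓡 r) (1 : G)) :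
    ∃ c : ℝ → G, c 0 = g ∧ IsMIntegralCurveAt c (fun h : G => aux r h x) 0 :=
  exists_isMIntegralCurveAt_of_contMDiffAt_boundaryless (I := 𝓡 r) 0 ((contMDiff_aux r x) g)

omit [AnalyticMoufangLoop r G] in
variable {r} in
theorem hasDerivAt_comp_integralCurve {x : TangentSpace (𝓡 r) (1 : G)} {c : ℝ → G}
    (hc : IsMIntegralCurveAt c (fun h : G => aux r h x) 0) {f : G → F}
    (hf : MDifferentiable (𝓡 r) 𝓘(ℝ, F) f) :
    ∀ᶠ t in 𝓝 (0 : ℝ), HasDerivAt (fun s => f (c s)) (tangentDeriv f (c t) (aux r (c t) x)) t :=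
  hc.mono fun t ht => hasDerivAt_comp_curve r (hf (c t)) ht

-- Only the velocity at `s = 0` is claimed: without associativity `s ↦ g c(s)` need not be an
-- integral curve of `v_x`.
variable {r} in
theorem hasDerivAt_mul_integralCurve {x : TangentSpace (𝓡 r) (1 : G)} {c : ℝ → G} (h0 : c 0 = 1)
    (hc : IsMIntegralCurveAt c (fun h : G => aux r h x) 0) {f : G → F}
    (hf : MDifferentiable (𝓡 r) 𝓘(ℝ, F) f) (g : G) :
    HasDerivAt (fun s => f (g * c s)) (tangentDeriv f g (aux r g x)) 0 := by
  have hd : MDifferentiable (𝓡 r) (𝓡 r) (fun h : G => g * h) :=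
    (contMDiff_mul_left r g).mdifferentiable (by simp)
  have h1 := (hasDerivAt_comp_integralCurve hc (hf.comp hd)).self_of_nhds
  convert! h1 using 1
  rw [h0, aux_one]
  have h2 := mfderiv_comp_apply (1 : G) (hf _) (hd 1) x
  refine Eq.trans ?_ h2.symm
  rw [mul_one']
  rfl

end AuxField

end MoufangLoop

/-! ### Differentiable birepresentations in the units of a finite-dimensional algebra -/

section Conjugation

variable {𝔸 : Type*} [NormedRing 𝔸] [NormedAlgebra ℝ 𝔸] [CompleteSpace 𝔸]

theorem HasDerivAt.units_inv {u : ℝ → 𝔸ˣ} {u' : 𝔸} {t : ℝ}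
    (hu : HasDerivAt (fun s => (u s : 𝔸)) u' t) :
    HasDerivAt (fun s => (((u s)⁻¹ : 𝔸ˣ) : 𝔸))
      (-(((u t)⁻¹ : 𝔸ˣ) * u' * ((u t)⁻¹ : 𝔸ˣ))) t := by
  have h2 := (hasFDerivAt_ringInverse (𝕜 := ℝ) (u t)).comp_hasDerivAt t hu
  simpa [Function.comp_def, mul_assoc] using! h2

theorem HasDerivAt.units_conj {u : ℝ → 𝔸ˣ} {Y : 𝔸} {t : ℝ}
    (hu : HasDerivAt (fun s => (u s : 𝔸)) (Y * u t) t) (X : 𝔸) :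
    HasDerivAt (fun s => (u s : 𝔸) * X * ((u s)⁻¹ : 𝔸ˣ))
      ⁅Y, (u t : 𝔸) * X * ((u t)⁻¹ : 𝔸ˣ)⁆ t := by
  convert (hu.mul_const X).fun_mul hu.units_inv using 1
  simp [Ring.lie_def, mul_assoc, sub_eq_add_neg]

theorem HasDerivAt.units_conj_inv {u : ℝ → 𝔸ˣ} {Y : 𝔸} {t : ℝ}
    (hu : HasDerivAt (fun s => (u s : 𝔸)) (u t * Y) t) (X : 𝔸) :
    HasDerivAt (fun s => (((u s)⁻¹ : 𝔸ˣ) : 𝔸) * X * (u s : 𝔸))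
      ⁅(((u t)⁻¹ : 𝔸ˣ) : 𝔸) * X * (u t : 𝔸), Y⁆ t := by
  convert (hu.units_inv.mul_const X).fun_mul hu using 1
  simp [Ring.lie_def, mul_assoc, sub_eq_add_neg, add_comm]

end Conjugation

namespace MoufangLoop

variable (r : ℕ) {G : Type*} [TopologicalSpace G] [ChartedSpace (EuclideanSpace ℝ (Fin r)) G]
  [MoufangLoop G]
  {𝔸 : Type*} [NormedRing 𝔸] [NormedAlgebra ℝ 𝔸]

/-- The derivative at the unit of a map into the units of an algebra. -/
noncomputable def unitGenerator (S : G → 𝔸ˣ) : TangentSpace (𝓡 r) (1 : G) →ₗ[ℝ] 𝔸 where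
  toFun x := tangentDeriv (fun g => (S g : 𝔸)) 1 x
  map_add' x y := map_add (mfderiv (𝓡 r) 𝓘(ℝ, 𝔸) (fun g => (S g : 𝔸)) 1) x y
  map_smul' c x := map_smul (mfderiv (𝓡 r) 𝓘(ℝ, 𝔸) (fun g => (S g : 𝔸)) 1) c x

/-- The derivative generators `T_g S_x T_g⁻¹`. -/
noncomputable def leftGenerator (S T : G → 𝔸ˣ) (g : G) :
    TangentSpace (𝓡 r) (1 : G) →ₗ[ℝ] 𝔸 :=
  LinearMap.mulLeftRight ℝ ((T g : 𝔸), (((T g)⁻¹ : 𝔸ˣ) : 𝔸)) ∘ₗ unitGenerator r S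

/-- The derivative generators `S_g⁻¹ T_x S_g`. -/
noncomputable def rightGenerator (S T : G → 𝔸ˣ) (g : G) :
    TangentSpace (𝓡 r) (1 : G) →ₗ[ℝ] 𝔸 :=
  LinearMap.mulLeftRight ℝ ((((S g)⁻¹ : 𝔸ˣ) : 𝔸), (S g : 𝔸)) ∘ₗ unitGenerator r T

theorem leftGenerator_apply (S T : G → 𝔸ˣ) (g : G) (x : TangentSpace (𝓡 r) (1 : G)) :
    leftGenerator r S T g x = (T g : 𝔸) * unitGenerator r S x * ((T g)⁻¹ : 𝔸ˣ) := rfl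

theorem rightGenerator_apply (S T : G → 𝔸ˣ) (g : G) (x : TangentSpace (𝓡 r) (1 : G)) :
    rightGenerator r S T g x = ((S g)⁻¹ : 𝔸ˣ) * unitGenerator r T x * (S g : 𝔸) := rfl

section Birep

variable [AnalyticMoufangLoop r G] [CompleteSpace 𝔸] {S T : G → 𝔸ˣ}
  (hST : IsGroupBirepresentation S T)
  (hS : MDifferentiable (𝓡 r) 𝓘(ℝ, 𝔸) fun g => (S g : 𝔸))
  (hT : MDifferentiable (𝓡 r) 𝓘(ℝ, 𝔸) fun g => (T g : 𝔸))

variable {r}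

omit [AnalyticMoufangLoop r G] [CompleteSpace 𝔸] in
include hS in
theorem hasDerivAt_unitGenerator {x : TangentSpace (𝓡 r) (1 : G)} {c : ℝ → G} (h0 : c 0 = 1)
    (hc : IsMIntegralCurveAt c (fun h : G => aux r h x) 0) :
    HasDerivAt (fun s => (S (c s) : 𝔸)) (unitGenerator r S x) 0 := by
  have h1 := (hasDerivAt_comp_integralCurve hc hS).self_of_nhds
  rw [h0, aux_one] at h1
  exact h1

-- Differentiate `S(gh) = S_g T_g S_h T_g⁻¹` in `h` at the unit.
omit [CompleteSpace 𝔸] in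
include hST hS in
theorem tangentDeriv_left (g : G) (x : TangentSpace (𝓡 r) (1 : G)) :
    tangentDeriv (fun g => (S g : 𝔸)) g (aux r g x) = S g * leftGenerator r S T g x := by
  obtain ⟨c, h0, hc⟩ := exists_integralCurve r (1 : G) x
  have h1 := hasDerivAt_mul_integralCurve h0 hc hS g
  have h2 := ((hasDerivAt_unitGenerator hS h0 hc).const_mul (S g * T g : 𝔸)).mul_const
    (((T g)⁻¹ : 𝔸ˣ) : 𝔸)
  simp only [hST.map_mul_left, Units.val_mul] at h1
  rw [h1.unique h2, leftGenerator_apply]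
  simp only [mul_assoc]

-- Differentiate `T(gh) = S_g⁻¹ T_h T_g S_g` in `h` at the unit and commute `T_g` with `S_g`.
omit [CompleteSpace 𝔸] in
include hST hT in
theorem tangentDeriv_right (g : G) (x : TangentSpace (𝓡 r) (1 : G)) :
    tangentDeriv (fun g => (T g : 𝔸)) g (aux r g x) = rightGenerator r S T g x * T g := by
  obtain ⟨c, h0, hc⟩ := exists_integralCurve r (1 : G) x
  have h1 := hasDerivAt_mul_integralCurve h0 hc hT g
  have h2 := ((hasDerivAt_unitGenerator hT h0 hc).const_mul (((S g)⁻¹ : 𝔸ˣ) : 𝔸)).mul_const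
    (T g * S g : 𝔸)
  simp only [hST.map_mul_right', Units.val_mul, mul_assoc] at h1 h2
  rw [h1.unique h2, rightGenerator_apply]
  have e : (T g : 𝔸) * S g = S g * T g := by exact_mod_cast congrArg Units.val (hST.comm g)
  simp only [mul_assoc, e]

-- Differentiate `T(gh) S(h) = S(h) T(h) T(g)` in `h` at the unit. The independence of `g` is the
-- source of the mixed relation.
omit [CompleteSpace 𝔸] in
include hST hS hT in
theorem leftGenerator_add_rightGenerator (g : G) (x : TangentSpace (𝓡 r) (1 : G)) :
    leftGenerator r S T g x + rightGenerator r S T g x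
      = unitGenerator r S x + unitGenerator r T x := by
  obtain ⟨c, h0, hc⟩ := exists_integralCurve r (1 : G) x
  have hs := hasDerivAt_unitGenerator hS h0 hc
  have ht := hasDerivAt_unitGenerator hT h0 hc
  have h1 := (hasDerivAt_mul_integralCurve h0 hc hT g).fun_mul hs
  have h2 := (hs.fun_mul ht).mul_const (T g : 𝔸)
  have e (t : ℝ) : (T (g * c t) : 𝔸) * S (c t) = S (c t) * T (c t) * T g := by
    rw [hST.map_mul_right]
    simp [mul_assoc]
  simp only [e] at h1
  have h3 := h1.unique h2
  simp only [h0, hST.left_one, hST.right_one, Units.val_one, mul_one, mul_one', one_mul,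
    tangentDeriv_right hST hT] at h3
  rw [leftGenerator_apply]
  have h4 := congrArg (· * (((T g)⁻¹ : 𝔸ˣ) : 𝔸)) h3
  simp only [add_mul, Units.mul_inv_cancel_right] at h4
  rw [add_comm, h4]

include hST hS hT

variable {x : TangentSpace (𝓡 r) (1 : G)} {c : ℝ → G}
  (hc : IsMIntegralCurveAt c (fun h : G => aux r h x) 0)
include hc

omit hS in
theorem hasDerivAt_leftGenerator (y : TangentSpace (𝓡 r) (1 : G)) :
    ∀ᶠ t in 𝓝 (0 : ℝ), HasDerivAt (fun s => leftGenerator r S T (c s) y)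
      ⁅rightGenerator r S T (c t) x, leftGenerator r S T (c t) y⁆ t := by
  filter_upwards [hasDerivAt_comp_integralCurve hc hT] with t ht
  rw [tangentDeriv_right hST hT] at ht
  exact HasDerivAt.units_conj (u := fun s => T (c s)) ht (unitGenerator r S y)

omit hT in
theorem hasDerivAt_rightGenerator (y : TangentSpace (𝓡 r) (1 : G)) :
    ∀ᶠ t in 𝓝 (0 : ℝ), HasDerivAt (fun s => rightGenerator r S T (c s) y)
      ⁅rightGenerator r S T (c t) y, leftGenerator r S T (c t) x⁆ t := by
  filter_upwards [hasDerivAt_comp_integralCurve hc hS] with t ht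
  rw [tangentDeriv_left hST hS] at ht
  exact HasDerivAt.units_conj_inv (u := fun s => S (c s)) ht (unitGenerator r T y)

end Birep

section Mul

theorem mdifferentiable_units_inv [CompleteSpace 𝔸] {M : Type*} [TopologicalSpace M]
    [ChartedSpace (EuclideanSpace ℝ (Fin r)) M] {U : M → 𝔸ˣ}
    (hU : MDifferentiable (𝓡 r) 𝓘(ℝ, 𝔸) fun g => (U g : 𝔸)) :
    MDifferentiable (𝓡 r) 𝓘(ℝ, 𝔸) fun g => (((U g)⁻¹ : 𝔸ˣ) : 𝔸) := by
  intro g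
  have h1 : MDifferentiableAt 𝓘(ℝ, 𝔸) 𝓘(ℝ, 𝔸) (Ring.inverse : 𝔸 → 𝔸) (U g) :=
    (hasFDerivAt_ringInverse (𝕜 := ℝ) (U g)).differentiableAt.mdifferentiableAt
  have h2 := h1.comp g (hU g)
  simpa [Function.comp_def] using! h2

theorem mdifferentiable_mul {M : Type*} [TopologicalSpace M]
    [ChartedSpace (EuclideanSpace ℝ (Fin r)) M] {p q : M → 𝔸}
    (hp : MDifferentiable (𝓡 r) 𝓘(ℝ, 𝔸) p) (hq : MDifferentiable (𝓡 r) 𝓘(ℝ, 𝔸) q) :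
    MDifferentiable (𝓡 r) 𝓘(ℝ, 𝔸) fun g => p g * q g := fun g =>
  ((hp g).hasMFDerivAt.mul' (hq g).hasMFDerivAt).mdifferentiableAt

end Mul

/-! ### The triality relations at each point of the loop. -/

section Triality

attribute [local instance] LieRing.ofAssociativeRing

variable [AnalyticMoufangLoop r G] [FiniteDimensional ℝ 𝔸] {S T : G → 𝔸ˣ}
  (hST : IsGroupBirepresentation S T)
  (hS : MDifferentiable (𝓡 r) 𝓘(ℝ, 𝔸) fun g => (S g : 𝔸))
  (hT : MDifferentiable (𝓡 r) 𝓘(ℝ, 𝔸) fun g => (T g : 𝔸))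

include hST hS hT

/-- The sum of the two generators in direction `y` is constant, so its derivative along `v_x`
vanishes. -/
theorem lie_left_right_eq_lie_right_left (g : G) (x y : TangentSpace (𝓡 r) (1 : G)) :
    ⁅leftGenerator r S T g x, rightGenerator r S T g y⁆
      = ⁅rightGenerator r S T g x, leftGenerator r S T g y⁆ := by
  have : CompleteSpace 𝔸 := FiniteDimensional.complete ℝ 𝔸
  obtain ⟨c, h0, hc⟩ := exists_integralCurve r g x
  have h1 := ((hasDerivAt_leftGenerator hST hT hc y).self_of_nhds).fun_add
    ((hasDerivAt_rightGenerator hST hS hc y).self_of_nhds)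
  simp only [leftGenerator_add_rightGenerator hST hS hT, h0] at h1
  have h2 := h1.unique (hasDerivAt_const _ _)
  rw [← lie_skew (rightGenerator r S T g y), ← sub_eq_add_neg, sub_eq_zero] at h2
  exact h2.symm

/-- At every point of an analytic Moufang loop the derivative generators of a birepresentation
form a triality pair with respect to the bracket of the loop at that point. -/
theorem isTrialityPair (g : G) :
    IsTrialityPair (bracket r g) (leftGenerator r S T g) (rightGenerator r S T g) := by
  have : CompleteSpace 𝔸 := FiniteDimensional.complete ℝ 𝔸
  have mixed := lie_left_right_eq_lie_right_left r hST hS hT g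
  have dL (x : TangentSpace (𝓡 r) (1 : G)) :
      MDifferentiable (𝓡 r) 𝓘(ℝ, 𝔸) fun h => leftGenerator r S T h x :=
    mdifferentiable_mul r (mdifferentiable_mul r hT mdifferentiable_const)
      (mdifferentiable_units_inv r hT)
  have dR (x : TangentSpace (𝓡 r) (1 : G)) :
      MDifferentiable (𝓡 r) 𝓘(ℝ, 𝔸) fun h => rightGenerator r S T h x :=
    mdifferentiable_mul r (mdifferentiable_mul r (mdifferentiable_units_inv r hS)
      mdifferentiable_const) hS
  have dSL (x : TangentSpace (𝓡 r) (1 : G)) := mdifferentiable_mul r hS (dL x)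
  have dRT (x : TangentSpace (𝓡 r) (1 : G)) := mdifferentiable_mul r (dR x) hT
  have hSL (x y : TangentSpace (𝓡 r) (1 : G)) :
      tangentDeriv (fun h => (S h : 𝔸) * leftGenerator r S T h y) g (aux r g x)
        = S g * (leftGenerator r S T g x * leftGenerator r S T g y
          + ⁅rightGenerator r S T g x, leftGenerator r S T g y⁆) := by
    obtain ⟨c, h0, hc⟩ := exists_integralCurve r g x
    have h1 := (hasDerivAt_comp_integralCurve hc (dSL y)).self_of_nhds
    have h2 := (hasDerivAt_comp_integralCurve hc hS).self_of_nhds.fun_mul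
      (hasDerivAt_leftGenerator hST hT hc y).self_of_nhds
    have h3 := h1.unique h2
    rw [h0, tangentDeriv_left hST hS] at h3
    rw [h3, mul_add, mul_assoc]
  have hRT (x y : TangentSpace (𝓡 r) (1 : G)) :
      tangentDeriv (fun h => rightGenerator r S T h y * (T h : 𝔸)) g (aux r g x)
        = (⁅rightGenerator r S T g y, leftGenerator r S T g x⁆
          + rightGenerator r S T g y * rightGenerator r S T g x) * T g := by
    obtain ⟨c, h0, hc⟩ := exists_integralCurve r g x
    have h1 := (hasDerivAt_comp_integralCurve hc (dRT y)).self_of_nhds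
    have h2 := (hasDerivAt_rightGenerator hST hS hc y).self_of_nhds.fun_mul
      (hasDerivAt_comp_integralCurve hc hT).self_of_nhds
    have h3 := h1.unique h2
    rw [h0, tangentDeriv_right hST hT] at h3
    rw [h3, add_mul, mul_assoc]
  refine ⟨mixed, fun x y => ?_, fun x y => ?_⟩
  -- The derivative of `S` along `[v_x, v_y]` is computed twice: as a commutator of derivations, and
  -- through `v_{[x,y]_g}`, which has the same value at `g`. The factor `S_g` then cancels.
  · have h1 := tangentDeriv_mlieBracket (E := EuclideanSpace ℝ (Fin r)) (g := g)
      (fun h => aux r h) (aux_isInvertible r) (fun x => mdifferentiableAt_aux r x g) hS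
      (Φ := fun x h => (S h : 𝔸) * leftGenerator r S T h x)
      (fun x h => tangentDeriv_left hST hS h x) dSL x y
    have h2 := tangentDeriv_left hST hS g (bracket r g x y)
    rw [aux_bracket] at h2
    have h3 := (h2.symm.trans h1).trans (congrArg₂ (· - ·) (hSL x y) (hSL y x))
    rw [← mul_sub] at h3
    rw [(S g).isUnit.mul_left_cancel h3, ← mixed, ← lie_skew (rightGenerator r S T g y),
      Ring.lie_def (leftGenerator r S T g x) (leftGenerator r S T g y), two_smul]
    abel
  · have h1 := tangentDeriv_mlieBracket (E := EuclideanSpace ℝ (Fin r)) (g := g)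
      (fun h => aux r h) (aux_isInvertible r) (fun x => mdifferentiableAt_aux r x g) hT
      (Φ := fun x h => rightGenerator r S T h x * (T h : 𝔸))
      (fun x h => tangentDeriv_right hST hT h x) dRT x y
    have h2 := tangentDeriv_right hST hT g (bracket r g x y)
    rw [aux_bracket] at h2
    have h3 := (h2.symm.trans h1).trans (congrArg₂ (· - ·) (hRT x y) (hRT y x))
    rw [← sub_mul] at h3
    rw [(T g).isUnit.mul_right_cancel h3, ← mixed x y, ← lie_skew (rightGenerator r S T g y),
      Ring.lie_def (rightGenerator r S T g x) (rightGenerator r S T g y), two_smul]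
    abel

end Triality

end MoufangLoop

namespace MoufangLoop

/-! ### Products of integral curves fill a neighbourhood of the unit -/

section Charts

variable {r : ℕ} {G : Type*} [TopologicalSpace G] [ChartedSpace (EuclideanSpace ℝ (Fin r)) G]
  [MoufangLoop G] [AnalyticMoufangLoop r G]

/-- Strictness, needed for the inverse function theorem, comes from continuity of the velocity
`v_x(c(t))` in the fixed chart at the unit. -/
theorem hasStrictDerivAt_extChartAt_integralCurve {x : TangentSpace (𝓡 r) (1 : G)} {c : ℝ → G}
    (h0 : c 0 = 1) (hc : IsMIntegralCurveAt c (fun h : G => aux r h x) 0) :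
    HasStrictDerivAt (fun t => extChartAt (𝓡 r) (1 : G) (c t))
      (x : EuclideanSpace ℝ (Fin r)) 0 := by
  have h1 := hc.eventually_hasDerivAt
  rw [h0] at h1
  let e := trivializationAt (EuclideanSpace ℝ (Fin r)) (TangentSpace (𝓡 r)) (1 : G)
  have he (g : G) (v : TangentSpace (𝓡 r) g) : (e ⟨g, v⟩).2 = tangentCoordChange (𝓡 r) g 1 g v :=
    rfl
  have h2 : ContinuousAt (fun t => tangentCoordChange (𝓡 r) (c t) 1 (c t) (aux r (c t) x)) 0 := by
    let σ : G → TangentBundle (𝓡 r) G := fun g => ⟨g, aux r g x⟩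
    have hσ : ContinuousAt σ (c 0) := (contMDiff_aux r x).continuous.continuousAt
    have hmem : σ (c 0) ∈ e.source := by
      rw [e.mem_source, h0]
      exact FiberBundle.mem_baseSet_trivializationAt' (1 : G)
    have he1 : ContinuousAt e (σ (c 0)) := e.continuousAt hmem
    have h3 : ContinuousAt (fun g : G => (e (σ g)).2) (c 0) :=
      (ContinuousAt.comp (f := σ) he1 hσ).snd
    exact ContinuousAt.comp (f := c) h3 hc.continuousAt
  have h4 := hasStrictDerivAt_of_hasDerivAt_of_continuousAt h1 h2
  have h5 : tangentCoordChange (𝓡 r) (c 0) 1 (c 0) (aux r (c 0) x) = x := by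
    rw [h0, aux_one]
    exact tangentCoordChange_self (I := 𝓡 r) (x := (1 : G)) (z := 1) (mem_extChartAt_source 1)
  rw [h5] at h4
  exact h4

/-- The differential of the multiplication at the unit, in the chart at the unit, is the sum. -/
theorem hasStrictFDerivAt_mul_extChartAt :
    HasStrictFDerivAt (fun q : EuclideanSpace ℝ (Fin r) × EuclideanSpace ℝ (Fin r) =>
        extChartAt (𝓡 r) (1 : G)
          ((extChartAt (𝓡 r) (1 : G)).symm q.1 * (extChartAt (𝓡 r) (1 : G)).symm q.2))
      (ContinuousLinearMap.fst ℝ (EuclideanSpace ℝ (Fin r)) (EuclideanSpace ℝ (Fin r)) +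
        ContinuousLinearMap.snd ℝ (EuclideanSpace ℝ (Fin r)) (EuclideanSpace ℝ (Fin r)))
      (extChartAt (𝓡 r) (1 : G) 1, extChartAt (𝓡 r) (1 : G) 1) := by
  set E := EuclideanSpace ℝ (Fin r)
  set φ := extChartAt (𝓡 r) (1 : G)
  set p := φ 1
  set m : E × E → E := fun q => φ (φ.symm q.1 * φ.symm q.2)
  have hφp : φ.symm p = 1 := extChartAt_to_inv (1 : G)
  have hsymm : ContMDiffAt 𝓘(ℝ, E) (𝓡 r) ω φ.symm p :=
    (contMDiffOn_extChartAt_symm (1 : G)).contMDiffAt (extChartAt_target_mem_nhds (1 : G))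
  have h1 : ContMDiffAt 𝓘(ℝ, E × E) (𝓡 r) ω (fun q : E × E => φ.symm q.1) (p, p) :=
    ContMDiffAt.comp (g := φ.symm) (f := Prod.fst) (p, p) hsymm
      contDiff_fst.contMDiff.contMDiffAt
  have h2 : ContMDiffAt 𝓘(ℝ, E × E) (𝓡 r) ω (fun q : E × E => φ.symm q.2) (p, p) :=
    ContMDiffAt.comp (g := φ.symm) (f := Prod.snd) (p, p) hsymm
      contDiff_snd.contMDiff.contMDiffAt
  have h3 : ContMDiffAt 𝓘(ℝ, E × E) (𝓡 r) ω (fun q : E × E => φ.symm q.1 * φ.symm q.2) (p, p) :=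
    ContMDiffAt.comp (g := fun q : G × G => q.1 * q.2)
      (f := fun q : E × E => (φ.symm q.1, φ.symm q.2)) (p, p)
      (AnalyticMoufangLoop.contMDiff_mul (r := r) (G := G)).contMDiffAt (h1.prodMk h2)
  have h4 : ContMDiffAt 𝓘(ℝ, E × E) 𝓘(ℝ, E) ω m (p, p) := by
    refine ContMDiffAt.comp (g := φ) (f := fun q : E × E => φ.symm q.1 * φ.symm q.2) (p, p) ?_ h3
    rw [hφp, mul_one']
    exact contMDiffAt_extChartAt
  have hm : HasStrictFDerivAt m (fderiv ℝ m (p, p)) (p, p) :=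
    h4.contDiffAt.hasStrictFDerivAt (by simp)
  have hφ : ∀ᶠ u in 𝓝 p, φ (φ.symm u) = u := by
    filter_upwards [extChartAt_target_mem_nhds (I := 𝓡 r) (1 : G)] with u hu
    exact φ.right_inv hu
  have hleft (a : E) : fderiv ℝ m (p, p) (a, 0) = a := by
    have h5 : HasFDerivAt (fun u : E => m (u, p))
        (fderiv ℝ m (p, p) ∘L ContinuousLinearMap.inl ℝ E E) p :=
      HasFDerivAt.comp p (g := m) hm.hasFDerivAt (hasFDerivAt_prodMk_left p p)
    have h6 : (fun u : E => m (u, p)) =ᶠ[𝓝 p] id := by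
      filter_upwards [hφ] with u hu
      simp [m, hφp, mul_one', hu]
    have := h5.unique ((hasFDerivAt_id p).congr_of_eventuallyEq h6)
    exact congrArg (fun D => D a) this
  have hright (a : E) : fderiv ℝ m (p, p) (0, a) = a := by
    have h5 : HasFDerivAt (fun u : E => m (p, u))
        (fderiv ℝ m (p, p) ∘L ContinuousLinearMap.inr ℝ E E) p :=
      HasFDerivAt.comp p (g := m) hm.hasFDerivAt (hasFDerivAt_prodMk_right p p)
    have h6 : (fun u : E => m (p, u)) =ᶠ[𝓝 p] id := by
      filter_upwards [hφ] with u hu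
      simp [m, hφp, one_mul', hu]
    have := h5.unique ((hasFDerivAt_id p).congr_of_eventuallyEq h6)
    exact congrArg (fun D => D a) this
  have he : fderiv ℝ m (p, p) = ContinuousLinearMap.fst ℝ E E + ContinuousLinearMap.snd ℝ E E := by
    refine ContinuousLinearMap.ext fun q => ?_
    obtain ⟨a, b⟩ := q
    have : ((a, b) : E × E) = (a, 0) + (0, b) := by simp
    rw [this, map_add, hleft, hright]
    simp
  rwa [he] at hm

/-- An ordered product of curves. -/
def curveProd (c : Fin r → ℝ → G) (l : List (Fin r)) (t : EuclideanSpace ℝ (Fin r)) : G :=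
  l.foldr (fun i g => c i (t i) * g) 1

omit [TopologicalSpace G] [ChartedSpace (EuclideanSpace ℝ (Fin r)) G]
  [AnalyticMoufangLoop r G] in
theorem curveProd_cons (c : Fin r → ℝ → G) (i : Fin r) (l : List (Fin r))
    (t : EuclideanSpace ℝ (Fin r)) : curveProd c (i :: l) t = c i (t i) * curveProd c l t := rfl

/-- A subloop which contains germs of integral curves in all directions is a neighbourhood of
the unit. -/
theorem IsSubloop.mem_nhds_one {M : Set G} (hM : IsSubloop M)
    (h : ∀ i : Fin r, ∃ c : ℝ → G, c 0 = 1 ∧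
      IsMIntegralCurveAt c (fun h : G =>
        aux r h (EuclideanSpace.single i (1 : ℝ) : EuclideanSpace ℝ (Fin r))) 0 ∧ ∀ᶠ t in 𝓝 (0 : ℝ), c t ∈ M) :
    M ∈ 𝓝 (1 : G) := by
  let E := EuclideanSpace ℝ (Fin r)
  let φ := extChartAt (𝓡 r) (1 : G)
  choose c hc0 hci hcM using h
  have hsource : φ.source ∈ 𝓝 (1 : G) := extChartAt_source_mem_nhds 1
  have hproj (i : Fin r) : Filter.Tendsto (fun t : E => t i) (𝓝 0) (𝓝 0) := by
    have : Continuous fun t : E => t i := (EuclideanSpace.proj (𝕜 := ℝ) i).continuous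
    simpa using this.tendsto (0 : E)
  -- In the chart, multiplication at the unit has differential `(a, b) ↦ a + b`, so each new factor
  -- adds its own direction `t_i e_i`.
  have key (l : List (Fin r)) : curveProd c l 0 = 1 ∧ ContinuousAt (curveProd c l) 0 ∧
      (∀ᶠ t in 𝓝 (0 : E), curveProd c l t ∈ M) ∧
      HasStrictFDerivAt (fun t => φ (curveProd c l t))
        (l.map fun i => (EuclideanSpace.proj (𝕜 := ℝ) i : E →L[ℝ] ℝ).smulRight
          (EuclideanSpace.single i (1 : ℝ) : E)).sum 0 := by
    induction l with
    | nil => exact ⟨rfl, continuousAt_const, .of_forall fun _ => hM.one_mem,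
        by simpa [curveProd] using! hasStrictFDerivAt_const (φ 1) (0 : E)⟩
    | cons i l ih =>
      obtain ⟨h0, hcont, hmem, hder⟩ := ih
      have hci0 : ContinuousAt (fun t : E => c i (t i)) 0 := by
        have h1 : ContinuousAt (c i) ((0 : E) i) := (hci i).continuousAt
        have h2 : ContinuousAt (fun t : E => t i) 0 :=
          (EuclideanSpace.proj (𝕜 := ℝ) i).continuous.continuousAt
        exact ContinuousAt.comp (f := fun t : E => t i) (g := c i) h1 h2
      have hmul : Continuous fun q : G × G => q.1 * q.2 :=
        (AnalyticMoufangLoop.contMDiff_mul (r := r) (G := G)).continuous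
      refine ⟨?_, ?_, ?_, ?_⟩
      · rw [curveProd_cons, h0, mul_one']; exact hc0 i
      · exact hmul.continuousAt.comp (hci0.prodMk hcont)
      · filter_upwards [(hproj i).eventually (hcM i), hmem] with t h1 h2
        exact hM.mul_mem h1 h2
      · have hd1 : HasStrictFDerivAt (fun t : E => φ (c i (t i)))
            ((EuclideanSpace.proj (𝕜 := ℝ) i : E →L[ℝ] ℝ).smulRight
              (EuclideanSpace.single i (1 : ℝ) : E)) 0 := by
          have h1 : HasStrictDerivAt (fun t => φ (c i t)) (EuclideanSpace.single i (1 : ℝ) : E)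
              ((0 : E) i) := hasStrictDerivAt_extChartAt_integralCurve (hc0 i) (hci i)
          have h2 := h1.hasStrictFDerivAt.comp (0 : E)
            (EuclideanSpace.proj (𝕜 := ℝ) i : E →L[ℝ] ℝ).hasStrictFDerivAt
          refine h2.congr_fderiv ?_
          ext1 v
          simp
        have h1 : φ (c i ((0 : E) i)) = φ 1 := congrArg φ (hc0 i)
        have h2 : φ (curveProd c l 0) = φ 1 := congrArg φ h0
        have hm := hasStrictFDerivAt_mul_extChartAt (r := r) (G := G)
        have hm' := HasStrictFDerivAt.comp (0 : E)
          (f := fun t : E => (φ (c i (t i)), φ (curveProd c l t)))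
          (by simpa only [h1, h2] using hm) (hd1.prodMk hder)
        have e : (fun t : E => φ (curveProd c (i :: l) t)) =ᶠ[𝓝 0]
            (fun q : E × E => φ (φ.symm q.1 * φ.symm q.2)) ∘
              fun t : E => (φ (c i (t i)), φ (curveProd c l t)) := by
          have s1 : ∀ᶠ t in 𝓝 (0 : E), c i (t i) ∈ φ.source :=
            hci0 (show φ.source ∈ 𝓝 (c i 0) by rw [hc0 i]; exact hsource)
          have s2 : ∀ᶠ t in 𝓝 (0 : E), curveProd c l t ∈ φ.source :=
            hcont (by rw [h0]; exact hsource)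
          filter_upwards [s1, s2] with t t1 t2
          simp only [Function.comp_apply, φ.left_inv t1, φ.left_inv t2, curveProd_cons]
        refine (hm'.congr_of_eventuallyEq e.symm).congr_fderiv ?_
        ext1 v
        simp
  obtain ⟨h0, hcont, hmem, hder⟩ := key (List.finRange r)
  have hid : ((List.finRange r).map fun i => (EuclideanSpace.proj (𝕜 := ℝ) i : E →L[ℝ] ℝ).smulRight
      (EuclideanSpace.single i (1 : ℝ) : E)).sum = (ContinuousLinearEquiv.refl ℝ E : E →L[ℝ] E) := by
    ext v j
    rw [← List.ofFn_eq_map, List.sum_ofFn]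
    simp [Pi.single_apply]
    rfl
  rw [hid] at hder
  -- Over all indices the differential is the identity, so the product of curves is open at `0`.
  have hmap := hder.map_nhds_eq_of_equiv
  have hgood : ∀ᶠ t in 𝓝 (0 : E), curveProd c (List.finRange r) t ∈ M ∩ φ.source :=
    hmem.and (hcont (by rw [h0]; exact hsource))
  have himg : (fun t => φ (curveProd c (List.finRange r) t)) ''
      {t | curveProd c (List.finRange r) t ∈ M ∩ φ.source} ∈ 𝓝 (φ 1) := by
    have := Filter.image_mem_map (m := fun t => φ (curveProd c (List.finRange r) t)) hgood
    rwa [hmap, h0] at this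
  have hφc : ContinuousAt φ (1 : G) := continuousAt_extChartAt 1
  filter_upwards [hφc himg, hsource] with g hg hgs
  obtain ⟨t, ⟨htM, hts⟩, ht⟩ := hg
  rwa [← φ.injOn hts hgs ht]

end Charts

end MoufangLoop

/-! ### Velocities in the group generated by a birepresentation. -/

namespace MoufangLoop

section VelocitySet

attribute [local instance] LieRing.ofAssociativeRing

variable (r : ℕ) {G : Type*} [TopologicalSpace G] [ChartedSpace (EuclideanSpace ℝ (Fin r)) G]
  [MoufangLoop G] [AnalyticMoufangLoop r G]
  {𝔸 : Type*} [NormedRing 𝔸] [NormedAlgebra ℝ 𝔸] [FiniteDimensional ℝ 𝔸] {S T : G → 𝔸ˣ}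

omit [AnalyticMoufangLoop r G] [FiniteDimensional ℝ 𝔸] in
theorem leftGenerator_one (hST : IsGroupBirepresentation S T) :
    leftGenerator r S T 1 = unitGenerator r S := by
  ext x
  simp [leftGenerator_apply, hST.right_one]

omit [AnalyticMoufangLoop r G] [FiniteDimensional ℝ 𝔸] in
theorem rightGenerator_one (hST : IsGroupBirepresentation S T) :
    rightGenerator r S T 1 = unitGenerator r T := by
  ext x
  simp [rightGenerator_apply, hST.left_one]

variable (hST : IsGroupBirepresentation S T)
  (hS : MDifferentiable (𝓡 r) 𝓘(ℝ, 𝔸) fun g => (S g : 𝔸))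
  (hT : MDifferentiable (𝓡 r) 𝓘(ℝ, 𝔸) fun g => (T g : 𝔸))

include hST hS hT

theorem lie_right_left_self (g : G) (x : TangentSpace (𝓡 r) (1 : G)) :
    ⁅rightGenerator r S T g x, leftGenerator r S T g x⁆ = 0 := by
  have h1 := lie_left_right_eq_lie_right_left r hST hS hT g x x
  rw [← lie_skew] at h1
  have h2 : (2 : ℝ) • ⁅rightGenerator r S T g x, leftGenerator r S T g x⁆ = 0 := by
    rw [two_smul]
    nth_rw 1 [← h1]
    exact neg_add_cancel _
  exact (smul_eq_zero.mp h2).resolve_left two_ne_zero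

variable {r}

/-- Along an integral curve through the unit, both parts of a birepresentation are
one-parameter groups. -/
theorem eventually_eq_oneParam_integralCurve {x : TangentSpace (𝓡 r) (1 : G)} {c : ℝ → G}
    (h0 : c 0 = 1) (hc : IsMIntegralCurveAt c (fun h : G => aux r h x) 0) :
    ∀ᶠ t in 𝓝 (0 : ℝ), S (c t) = oneParam (unitGenerator r S x) t ∧
      T (c t) = oneParam (unitGenerator r T x) t := by
  have : CompleteSpace 𝔸 := FiniteDimensional.complete ℝ 𝔸
  -- Since `[R_x, L_x] = 0`, the generators in direction `x` are constant along the curve, and `S`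
  -- and `T` satisfy linear equations with constant coefficients.
  have hL := eventually_eq_of_hasDerivAt_zero
    ((hasDerivAt_leftGenerator hST hT hc x).mono fun t ht => by
      rwa [lie_right_left_self r hST hS hT] at ht)
  have hR := eventually_eq_of_hasDerivAt_zero
    ((hasDerivAt_rightGenerator hST hS hc x).mono fun t ht => by
      rwa [lie_right_left_self r hST hS hT] at ht)
  rw [h0, leftGenerator_one r hST] at hL
  rw [h0, rightGenerator_one r hST] at hR
  have h1 := eventually_eq_oneParam' (a := fun t => (S (c t) : 𝔸)) (X := unitGenerator r S x)
    (by simp [h0, hST.left_one]) (by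
      filter_upwards [hasDerivAt_comp_integralCurve hc hS, hL] with t ht hLt
      rwa [tangentDeriv_left hST hS, hLt] at ht)
  have h2 := eventually_eq_oneParam (a := fun t => (T (c t) : 𝔸)) (X := unitGenerator r T x)
    (by simp [h0, hST.right_one]) (by
      filter_upwards [hasDerivAt_comp_integralCurve hc hT, hR] with t ht hRt
      rwa [tangentDeriv_right hST hT, hRt] at ht)
  filter_upwards [h1, h2] with t t1 t2
  exact ⟨Units.ext t1, Units.ext t2⟩

/-- The velocities at the identity of the curves in the group generated by a birepresentation of
a connected analytic Moufang loop form the span of the generators and Yamagutians at the unit. -/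
theorem velocitySet_closure_range_union_range [ConnectedSpace G] :
    velocitySet (Subgroup.closure (Set.range S ∪ Set.range T))
      = (pairSpan (leftGenerator r S T (1 : G)) (rightGenerator r S T (1 : G)) : Set 𝔸) := by
  have : CompleteSpace 𝔸 := FiniteDimensional.complete ℝ 𝔸
  set H := Subgroup.closure (Set.range S ∪ Set.range T) with hH
  rw [leftGenerator_one r hST, rightGenerator_one r hST]
  have htri := isTrialityPair r hST hS hT (1 : G)
  rw [leftGenerator_one r hST, rightGenerator_one r hST] at htri
  apply Set.Subset.antisymm
  · let e (i : Fin r) : TangentSpace (𝓡 r) (1 : G) :=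
      (EuclideanSpace.single i (1 : ℝ) : EuclideanSpace ℝ (Fin r))
    -- Only basis directions are taken, because the countability argument needs a countable set of
    -- exponents.
    let B : Set 𝔸 := Set.range (fun i => unitGenerator r S (e i)) ∪
      Set.range fun i => unitGenerator r T (e i)
    have hBS (i : Fin r) : unitGenerator r S (e i) ∈ B := Or.inl ⟨i, rfl⟩
    have hBT (i : Fin r) : unitGenerator r T (e i) ∈ B := Or.inr ⟨i, rfl⟩
    have hnhds := (hST.isSubloop_preimage (expGroup B)).mem_nhds_one (r := r) fun i => by
      obtain ⟨c, h0, hc⟩ := exists_integralCurve r (1 : G) (e i)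
      refine ⟨c, h0, hc, ?_⟩
      filter_upwards [eventually_eq_oneParam_integralCurve hST hS hT h0 hc] with t ht
      refine ⟨?_, ?_⟩
      · rw [ht.1]; exact oneParam_mem_expGroup (hBS i) t
      · rw [ht.2]; exact oneParam_mem_expGroup (hBT i) t
    have huniv := (hST.isSubloop_preimage (expGroup B)).eq_univ r hnhds
    have hmem (g : G) : S g ∈ expGroup B ∧ T g ∈ expGroup B := by
      have : g ∈ {g : G | S g ∈ expGroup B ∧ T g ∈ expGroup B} := huniv ▸ Set.mem_univ g
      exact this
    have hle : H ≤ expGroup B := by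
      rw [hH, Subgroup.closure_le]
      rintro _ (⟨g, rfl⟩ | ⟨g, rfl⟩)
      exacts [(hmem g).1, (hmem g).2]
    refine (velocitySet_mono hle).trans (velocitySet_expGroup_subset
      (fun X hX Y hY => htri.lie_mem_pairSpan (bracket_neg_right r 1) (bracket_neg_left r 1) hX hY)
      ?_ ((Set.countable_range _).union (Set.countable_range _)))
    rintro _ (⟨i, rfl⟩ | ⟨i, rfl⟩)
    exacts [left_mem_pairSpan _ _ _, right_mem_pairSpan _ _ _]
  -- For small `t` the one-parameter groups of `S_x` and `T_x` consist of values of `S` and `T`; the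
  -- Yamagutians follow by brackets.
  · have hmem (x : TangentSpace (𝓡 r) (1 : G)) : unitGenerator r S x ∈ velocitySubmodule H ∧
        unitGenerator r T x ∈ velocitySubmodule H := by
      obtain ⟨c, h0, hc⟩ := exists_integralCurve r (1 : G) x
      have h1 := eventually_eq_oneParam_integralCurve hST hS hT h0 hc
      exact ⟨mem_velocitySubmodule_of_oneParam (h1.mono fun t ht =>
          ht.1 ▸ Subgroup.subset_closure (Or.inl ⟨_, rfl⟩)),
        mem_velocitySubmodule_of_oneParam (h1.mono fun t ht =>
          ht.2 ▸ Subgroup.subset_closure (Or.inr ⟨_, rfl⟩))⟩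
    have hle : pairSpan (unitGenerator r S) (unitGenerator r T) ≤ velocitySubmodule H := by
      refine Submodule.span_le.mpr ?_
      rintro _ ((⟨x, rfl⟩ | ⟨x, rfl⟩) | ⟨x, y, rfl⟩)
      · exact (hmem x).1
      · exact (hmem x).2
      · exact Submodule.smul_mem _ _ (add_mem (add_mem
          (lie_mem_velocitySubmodule (hmem x).1 (hmem y).1)
          (lie_mem_velocitySubmodule (hmem x).1 (hmem y).2))
          (lie_mem_velocitySubmodule (hmem x).2 (hmem y).2))
    exact hle

end VelocitySet

end MoufangLoop

/-! ### Differentiability in linear coordinates -/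

section Coordinates

variable {E F : Type*} {ι : Type} [NormedAddCommGroup E] [NormedSpace ℝ E] [NormedAddCommGroup F]
  [NormedSpace ℝ F] [FiniteDimensional ℝ E]

theorem HasDerivAt.linearMap_comp (L : E →ₗ[ℝ] F) {γ : ℝ → E} {X : E} {t : ℝ}
    (h : HasDerivAt γ X t) : HasDerivAt (fun s => L (γ s)) (L X) t :=
  (LinearMap.toContinuousLinearMap L).hasFDerivAt.comp_hasDerivAt t h

theorem ContDiffAt.linearMap_comp (L : E →ₗ[ℝ] F) {γ : ℝ → E} {t : ℝ} {k : ℕ∞ω}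
    (h : ContDiffAt ℝ k γ t) : ContDiffAt ℝ k (fun s => L (γ s)) t :=
  (LinearMap.toContinuousLinearMap L).contDiff.contDiffAt.comp t h

variable [Fintype ι] (π : ι → E →ₗ[ℝ] F) (σ : ι → F →ₗ[ℝ] E) (hσ : ∀ x, ∑ k, σ k (π k x) = x)

include hσ

theorem contDiffAt_and_hasDerivAt_iff [FiniteDimensional ℝ F] {γ : ℝ → E} {X : E} {t : ℝ}
    {k : ℕ∞ω} :
    ContDiffAt ℝ k γ t ∧ HasDerivAt γ X t ↔
      ∀ i, ContDiffAt ℝ k (fun s => π i (γ s)) t ∧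
        HasDerivAt (fun s => π i (γ s)) (π i X) t := by
  refine ⟨fun h i => ⟨h.1.linearMap_comp (π i), h.2.linearMap_comp (π i)⟩, fun h => ?_⟩
  have e : γ = fun s => ∑ i, σ i (π i (γ s)) := funext fun s => (hσ (γ s)).symm
  rw [e, ← hσ X]
  exact ⟨ContDiffAt.sum fun i _ => (h i).1.linearMap_comp (σ i),
    HasDerivAt.fun_sum fun i _ => (h i).2.linearMap_comp (σ i)⟩

variable {r : ℕ} {G : Type*} [TopologicalSpace G] [ChartedSpace (EuclideanSpace ℝ (Fin r)) G]

omit [FiniteDimensional ℝ E] in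
theorem mdifferentiable_of_coordinates [FiniteDimensional ℝ F] {f : G → E}
    (h : ∀ i, MDifferentiable (𝓡 r) 𝓘(ℝ, F) fun g => π i (f g)) :
    MDifferentiable (𝓡 r) 𝓘(ℝ, E) f := by
  have e : f = ∑ i, fun g => σ i (π i (f g)) := by
    funext g
    rw [Finset.sum_apply, hσ]
  rw [e]
  exact MDifferentiable.sum fun i _ =>
    (LinearMap.toContinuousLinearMap (σ i)).differentiable.mdifferentiable.comp (h i)

omit hσ [Fintype ι] in
theorem tangentDeriv_linearMap_comp (L : E →ₗ[ℝ] F) {f : G → E} {g : G}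
    (hf : MDifferentiableAt (𝓡 r) 𝓘(ℝ, E) f g) (v : TangentSpace (𝓡 r) g) :
    L (tangentDeriv f g v) = tangentDeriv (fun h => L (f h)) g v := by
  let D := LinearMap.toContinuousLinearMap L
  have h1 := mfderiv_comp_apply (I' := 𝓘(ℝ, E)) (I'' := 𝓘(ℝ, F)) g (g := D)
    D.differentiableAt.mdifferentiableAt hf v
  refine Eq.trans ?_ h1.symm
  rw [mfderiv_eq_fderiv, ContinuousLinearMap.fderiv]
  rfl

end Coordinates

/-! ### Transfer from normed algebras to matrices. -/

namespace Birepresentation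

section Matrix

attribute [local instance] LieRing.ofAssociativeRing Matrix.linftyOpNormedRing
  Matrix.linftyOpNormedAlgebra

open MoufangLoop

variable {𝕜 : Type*} [RCLike 𝕜] {n : ℕ}

theorem sum_singleLinearMap (A : Matrix (Fin n) (Fin n) 𝕜) :
    ∑ p : Fin n × Fin n, Matrix.singleLinearMap ℝ p.1 p.2 (Matrix.entryLinearMap ℝ 𝕜 p.1 p.2 A)
      = A := by
  rw [Fintype.sum_prod_type]
  exact (Matrix.matrix_eq_sum_single A).symm

/-- The matrix norm is auxiliary: in finite dimension, differentiability in norm and entry by entry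
agree. -/
theorem linearGroupLieAlgebra_eq_velocitySet (H : Subgroup (GL (Fin n) 𝕜)) :
    linearGroupLieAlgebra H = velocitySet H := by
  ext X
  refine exists_congr fun γ => and_congr_right fun _ => and_congr_right fun _ => ?_
  refine Iff.trans ?_ (contDiffAt_and_hasDerivAt_iff _ _ sum_singleLinearMap).symm
  exact ⟨fun h p => h p.1 p.2, fun h i j => h (i, j)⟩

variable {r : ℕ} {G : Type*} [TopologicalSpace G] [ChartedSpace (EuclideanSpace ℝ (Fin r)) G]
  [MoufangLoop G]

theorem generator_eq_unitGenerator {S : G → GL (Fin n) 𝕜} (hS : IsDifferentiable r S)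
    (x : TangentSpace (𝓡 r) (1 : G)) : generator r S x = unitGenerator r S x := by
  ext i j
  exact (tangentDeriv_linearMap_comp (Matrix.entryLinearMap ℝ 𝕜 i j)
    (mdifferentiable_of_coordinates _ _ sum_singleLinearMap (fun p => hS p.1 p.2) 1) x).symm

theorem genS_eq_leftGenerator {S : G → GL (Fin n) 𝕜} (hS : IsDifferentiable r S)
    (T : G → GL (Fin n) 𝕜) (g : G) : genS r S T g = leftGenerator r S T g := by
  funext x
  rw [genS, generator_eq_unitGenerator hS]
  rfl

theorem genT_eq_rightGenerator {T : G → GL (Fin n) 𝕜} (hT : IsDifferentiable r T)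
    (S : G → GL (Fin n) 𝕜) (g : G) : genT r S T g = rightGenerator r S T g := by
  funext x
  rw [genT, generator_eq_unitGenerator hT]
  rfl

omit [TopologicalSpace G] in
theorem _root_.IsBirepresentation.isGroupBirepresentation {S T : G → GL (Fin n) 𝕜}
    (hST : IsBirepresentation S T) : IsGroupBirepresentation S T :=
  ⟨hST.left_one, hST.right_one, hST.left_mul, hST.right_mul⟩

section

variable [AnalyticMoufangLoop r G] {S T : G → GL (Fin n) 𝕜} (hST : IsBirepresentation S T)
  (hS : IsDifferentiable r S) (hT : IsDifferentiable r T)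
include hS hT

omit [AnalyticMoufangLoop r G] in
theorem yamagutian_eq_pairYamagutian (g : G) (x y : TangentSpace (𝓡 r) (1 : G)) :
    yamagutian r S T g x y
      = pairYamagutian (leftGenerator r S T g) (rightGenerator r S T g) x y := by
  rw [yamagutian, genS_eq_leftGenerator hS, genT_eq_rightGenerator hT]
  rfl

omit [AnalyticMoufangLoop r G] in
theorem generatorSpan_eq_pairSpan (g : G) :
    generatorSpan r S T g = pairSpan (leftGenerator r S T g) (rightGenerator r S T g) := by
  simp only [generatorSpan, genS_eq_leftGenerator hS, genT_eq_rightGenerator hT,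
    yamagutian_eq_pairYamagutian hS hT]
  rfl

include hST

theorem isTrialityPair_generators (g : G) :
    IsTrialityPair (bracket r g) (leftGenerator r S T g) (rightGenerator r S T g) :=
  isTrialityPair r hST.isGroupBirepresentation
    (mdifferentiable_of_coordinates _ _ sum_singleLinearMap fun p => hS p.1 p.2)
    (mdifferentiable_of_coordinates _ _ sum_singleLinearMap fun p => hT p.1 p.2) g

theorem commutator_identities (g : G) (x y z w : TangentSpace (𝓡 r) (1 : G)) :
      ⁅genS r S T g x, genS r S T g y⁆ = (2 : ℝ) • yamagutian r S T g x y
        + (1 / 3 : ℝ) • genS r S T g (bracket r g x y)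
        + (2 / 3 : ℝ) • genT r S T g (bracket r g x y) ∧
      ⁅genS r S T g x, genT r S T g y⁆ = -yamagutian r S T g x y
        + (1 / 3 : ℝ) • genS r S T g (bracket r g x y)
        - (1 / 3 : ℝ) • genT r S T g (bracket r g x y) ∧
      ⁅genT r S T g x, genT r S T g y⁆ = (2 : ℝ) • yamagutian r S T g x y
        - (2 / 3 : ℝ) • genS r S T g (bracket r g x y)
        - (1 / 3 : ℝ) • genT r S T g (bracket r g x y) ∧
      (6 : ℝ) • ⁅yamagutian r S T g x y, genS r S T g z⁆
        = genS r S T g (yamaguti r g x y z) ∧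
      (6 : ℝ) • ⁅yamagutian r S T g x y, genT r S T g z⁆
        = genT r S T g (yamaguti r g x y z) ∧
      (6 : ℝ) • ⁅yamagutian r S T g x y, yamagutian r S T g z w⁆
        = yamagutian r S T g (yamaguti r g x y z) w
          + yamagutian r S T g z (yamaguti r g x y w) := by
  have h := isTrialityPair_generators hST hS hT g
  have hl := bracket_neg_right r g
  have hr := bracket_neg_left r g
  simp only [genS_eq_leftGenerator hS, genT_eq_rightGenerator hT,
    yamagutian_eq_pairYamagutian hS hT]
  exact ⟨h.lie_left_left x y, h.lie_left_right x y, h.lie_right_right x y,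
    h.lie_yamagutian_left x y z, h.lie_yamagutian_right hl hr x y z,
    h.lie_yamagutian_yamagutian hl hr x y z w⟩

theorem lie_mem_generatorSpan (g : G) {A B : Matrix (Fin n) (Fin n) 𝕜}
    (hA : A ∈ generatorSpan r S T g) (hB : B ∈ generatorSpan r S T g) :
    ⁅A, B⁆ ∈ generatorSpan r S T g := by
  rw [generatorSpan_eq_pairSpan hS hT] at hA hB ⊢
  exact (isTrialityPair_generators hST hS hT g).lie_mem_pairSpan (bracket_neg_right r g)
    (bracket_neg_left r g) hA hB

theorem finrank_generatorSpan_le (g : G) :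
    Module.finrank ℝ (generatorSpan r S T g) ≤ 2 * r + r * (r - 1) / 2 := by
  rw [generatorSpan_eq_pairSpan hS hT]
  exact (isTrialityPair_generators hST hS hT g).finrank_pairSpan_le
    (EuclideanSpace.basisFun (Fin r) ℝ).toBasis

theorem linearGroupLieAlgebra_multiplicationGroup [ConnectedSpace G] :
    linearGroupLieAlgebra (multiplicationGroup S T) =
      (generatorSpan r S T (1 : G) : Set (Matrix (Fin n) (Fin n) 𝕜)) := by
  rw [linearGroupLieAlgebra_eq_velocitySet, generatorSpan_eq_pairSpan hS hT]
  exact velocitySet_closure_range_union_range hST.isGroupBirepresentation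
    (mdifferentiable_of_coordinates _ _ sum_singleLinearMap fun p => hS p.1 p.2)
    (mdifferentiable_of_coordinates _ _ sum_singleLinearMap fun p => hT p.1 p.2)

end

end Matrix

end Birepresentation

open MoufangLoop Birepresentation in
theorem mainTheorem3 {r n : ℕ} {G : Type*} [TopologicalSpace G]
    [ChartedSpace (EuclideanSpace ℝ (Fin r)) G] [MoufangLoop G] [AnalyticMoufangLoop r G]
    {𝕜 : Type*} [RCLike 𝕜] (S T : G → GL (Fin n) 𝕜) (hST : IsBirepresentation S T)
    (hS : IsDifferentiable r S) (hT : IsDifferentiable r T) :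
    (∀ (g : G) (x y z w : TangentSpace (𝓡 r) (1 : G)),
      ⁅genS r S T g x, genS r S T g y⁆ = (2 : ℝ) • yamagutian r S T g x y
        + (1 / 3 : ℝ) • genS r S T g (bracket r g x y)
        + (2 / 3 : ℝ) • genT r S T g (bracket r g x y) ∧
      ⁅genS r S T g x, genT r S T g y⁆ = -yamagutian r S T g x y
        + (1 / 3 : ℝ) • genS r S T g (bracket r g x y)
        - (1 / 3 : ℝ) • genT r S T g (bracket r g x y) ∧
      ⁅genT r S T g x, genT r S T g y⁆ = (2 : ℝ) • yamagutian r S T g x y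
        - (2 / 3 : ℝ) • genS r S T g (bracket r g x y)
        - (1 / 3 : ℝ) • genT r S T g (bracket r g x y) ∧
      (6 : ℝ) • ⁅yamagutian r S T g x y, genS r S T g z⁆
        = genS r S T g (yamaguti r g x y z) ∧
      (6 : ℝ) • ⁅yamagutian r S T g x y, genT r S T g z⁆
        = genT r S T g (yamaguti r g x y z) ∧
      (6 : ℝ) • ⁅yamagutian r S T g x y, yamagutian r S T g z w⁆
        = yamagutian r S T g (yamaguti r g x y z) w
          + yamagutian r S T g z (yamaguti r g x y w)) ∧
    (∀ g : G, (∀ A ∈ generatorSpan r S T g, ∀ B ∈ generatorSpan r S T g,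
        ⁅A, B⁆ ∈ generatorSpan r S T g) ∧
      Module.finrank ℝ (generatorSpan r S T g) ≤ 2 * r + r * (r - 1) / 2) ∧
    (ConnectedSpace G →
      linearGroupLieAlgebra (multiplicationGroup S T) =
        (generatorSpan r S T (1 : G) : Set (Matrix (Fin n) (Fin n) 𝕜))) :=
  ⟨commutator_identities hST hS hT,
    fun g => ⟨fun _ hA _ hB => lie_mem_generatorSpan hST hS hT g hA hB,
      finrank_generatorSpan_le hST hS hT g⟩,
    fun _ => linearGroupLieAlgebra_multiplicationGroup hST hS hT⟩
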